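/- For a finite group $G$ with identity $e$, let $\mathscr G_3(G)=\mathrm{Cay}(G^3,\mathbf S_3)$ be the Cayley graph on $G^3=G\times G\times G$ with connection set $$\mathbf S_3=\{(g,e,e),(e,g,e),(e,e,g),(g,g,e),(e,g,g),(g,g,g)\mid g\in G\setminus\{e\}\},$$ that is, $u,v\in G^3$ are adjacent if and only if $v=su$ for some $s\in\mathbf S_3$. For $r\ge 4$ let $$L_r=\langle a,b\mid a^{3^{r-1}}=b^3=1,\ bab^{-1}=a^{1+3^{r-2}}\rangle .$$ Let $G$ be a finite nilpotent group of odd order whose Sylow $3$-subgroup is neither cyclic of order greater than $1$ nor isomorphic to any group $L_r$ with $r\ge 4$. Then the chromatic number of $\mathscr G_3(G)$ equals the order of $G$: $$\chi(\mathscr G_3(G))=|G|.$$ -/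

import Mathlib

/-- The Cayley graph `Cay(Γ, S)`: distinct vertices `u`, `v` are adjacent when `v = s * u` or
`u = s * v` for some `s ∈ S` (generators act by multiplication on the left). -/
def leftCayley {Γ : Type*} [Group Γ] (S : Set Γ) : SimpleGraph Γ :=
  SimpleGraph.fromRel fun u v => ∃ s ∈ S, s * u = v

/-- The connection set
`S₃ = {(g,e,e), (e,g,e), (e,e,g), (g,g,e), (e,g,g), (g,g,g) ∣ g ≠ e}` in `G³`. -/
def connectionSet3 (G : Type*) [Group G] : Set (G × G × G) :=
  {s | ∃ g : G, g ≠ 1 ∧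
    (s = (g, 1, 1) ∨ s = (1, g, 1) ∨ s = (1, 1, g) ∨
      s = (g, g, 1) ∨ s = (1, g, g) ∨ s = (g, g, g))}

/-- The graph `𝒢₃(G) = Cay(G³, S₃)`. -/
def graphG3 (G : Type*) [Group G] : SimpleGraph (G × G × G) :=
  leftCayley (connectionSet3 G)

/-- The relators of `⟨a, b ∣ a ^ (3 ^ (r-1)) = b ^ 3 = 1, b a b⁻¹ = a ^ (1 + 3 ^ (r-2))⟩`,
with `a`, `b` the free generators indexed by `0`, `1`. -/
def relatorsL (r : ℕ) : Set (FreeGroup (Fin 2)) :=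
  let a : FreeGroup (Fin 2) := FreeGroup.of 0
  let b : FreeGroup (Fin 2) := FreeGroup.of 1
  {a ^ (3 ^ (r - 1)), b ^ 3, (b * a * b⁻¹) * (a ^ (1 + 3 ^ (r - 2)))⁻¹}

/-- The group `L_r = ⟨a, b ∣ a ^ (3 ^ (r-1)) = b ^ 3 = 1, b a b⁻¹ = a ^ (1 + 3 ^ (r-2))⟩`
(meaningful for `r ≥ 2`; only used for `r ≥ 4`). -/
abbrev groupL (r : ℕ) : Type :=
  PresentedGroup (relatorsL r)

/-!
`|G|` colours are necessary because the elements `(g, 1, 1)` form a clique. Call `G` *tight* if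
`|G|` colours suffice. The proof rests on the observation that tightness passes to extensions: if
a normal subgroup `N` and the quotient `G ⧸ N` are tight, colour `x = k * s`, with `k ∈ N` and `s`
a chosen coset representative, by the pair of the colours of the cosets and of the `N`-parts
(`Tight.of_extension`). No hypothesis on the extension is needed.

The Sylow `3`-subgroup `P` of `G` is normal, and `G ⧸ P` is nilpotent of order prime to `6`. It
has a central series with factors coloured by `x * y * z`, so it is tight
(`tight_of_isNilpotent`).

It remains to show that a non-cyclic `3`-group is tight unless it is some `L_r` with `r ≥ 4`
(`IsPGroup.tight_or_isModular`). Extensions reduce this to a few groups that are coloured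
directly:

* `ℤ/3 × ℤ/3N` with `N` odd (`tight_zmod_three_prod`). In an abelian group `A` of odd order it is
  enough to find a map `θ` such that `θ`, `θ - id` and `θ + id` are bijective; `(x, y, z)` then
  receives the colour `x + y - z + θ z`. The map `θ` given here is built from a function `ℤ/3N →
  ℤ/3` that steps by one over each period `N`.
* the groups of order `27` and exponent `3`, and the non-abelian group of order `27` and exponent
  `9`, coloured by explicit polynomials modulo `3` in suitable coordinates
  (`tight_of_card_twentySeven`).

The reduction is an induction on the order. Two maximal subgroups of a non-cyclic `3`-group `G`
intersect in a normal subgroup `K` with `G ⧸ K ≃ ℤ/3 × ℤ/3`, which is tight. If `K` is tight, so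
is `G`. If `K` is modular, that is `K ≃ L_r` with `r ≥ 4`, its characteristic subgroup `⟨a ^ 3,
b⟩` is tight, and its quotient in `G` has order `27` and is tight by induction. If `K` is cyclic,
then either some cube generates `K`, in which case `G` has a cyclic subgroup of index `3` and is
abelian, modular or of order `27` (`tight_or_isModular_of_cyclic`), or `G` has order `27` and
exponent `3`, or `K` can be replaced by an abelian non-cyclic subgroup (`tight_of_pow_three_mem`).
-/

/-! ### Tight colourings and extensions -/

/-- A map `c` on `G³` that changes under every non-trivial left translation along one of the six
directions `(1,0,0)`, `(0,1,0)`, `(0,0,1)`, `(1,1,0)`, `(0,1,1)`, `(1,1,1)`; equivalently, a proper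
colouring of `graphG3 G`. -/
def IsProperOnCube {G C : Type*} [Group G] (c : G → G → G → C) : Prop :=
  ∀ g : G, g ≠ 1 → ∀ x y z : G,
    c (g * x) y z ≠ c x y z ∧ c x (g * y) z ≠ c x y z ∧ c x y (g * z) ≠ c x y z ∧
    c (g * x) (g * y) z ≠ c x y z ∧ c x (g * y) (g * z) ≠ c x y z ∧
    c (g * x) (g * y) (g * z) ≠ c x y z

/-- `G` is *tight* if `graphG3 G` has a proper colouring with colour set `G`, that is, with as many
colours as the clique `{(g, 1, 1) ∣ g ∈ G}` needs. -/
def Tight (G : Type*) [Group G] : Prop :=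
  ∃ c : G → G → G → G, IsProperOnCube c

theorem IsProperOnCube.tight {G C : Type*} [Group G] {c : G → G → G → C}
    (hc : IsProperOnCube c) (e : C ≃ G) : Tight G :=
  ⟨fun x y z => e (c x y z), fun g hg x y z => by
    simpa only [ne_eq, e.apply_eq_iff_eq] using hc g hg x y z⟩

theorem Tight.of_mulEquiv {G H : Type*} [Group G] [Group H] (e : G ≃* H) (hG : Tight G) :
    Tight H := by
  obtain ⟨c, hc⟩ := hG
  refine ⟨fun x y z => e (c (e.symm x) (e.symm y) (e.symm z)), fun g hg x y z => ?_⟩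
  have hg' : e.symm g ≠ 1 := by simpa using hg
  simpa only [ne_eq, e.apply_eq_iff_eq, map_mul] using
    hc (e.symm g) hg' (e.symm x) (e.symm y) (e.symm z)

theorem tight_of_subsingleton (G : Type*) [Group G] [Subsingleton G] : Tight G :=
  ⟨fun _ _ _ => 1, fun g hg => absurd (Subsingleton.elim g 1) hg⟩

/-- The lower bound comes from the clique `{(g, 1, 1) ∣ g ∈ G}`. -/
theorem Tight.chromaticNumber_eq {G : Type*} [Group G] [Finite G] (hG : Tight G) :
    (graphG3 G).chromaticNumber = (Nat.card G : ℕ∞) := by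
  classical
  have := Fintype.ofFinite G
  rw [Nat.card_eq_fintype_card]
  apply le_antisymm
  · obtain ⟨c, hc⟩ := hG
    have key : ∀ u v : G × G × G, (∃ s ∈ connectionSet3 G, s * u = v) →
        c v.1 v.2.1 v.2.2 ≠ c u.1 u.2.1 u.2.2 := by
      rintro ⟨x, y, z⟩ v ⟨s, ⟨g, hg, hs⟩, rfl⟩
      have h := hc g hg x y z
      rcases hs with rfl | rfl | rfl | rfl | rfl | rfl <;>
        simp only [Prod.mk_mul_mk, one_mul] <;> tauto
    have col : (graphG3 G).Coloring G :=
      SimpleGraph.Coloring.mk (fun u => c u.1 u.2.1 u.2.2) (by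
        intro u v huv
        rw [graphG3, leftCayley, SimpleGraph.fromRel_adj] at huv
        rcases huv.2 with h | h
        · exact (key u v h).symm
        · exact key v u h)
    exact col.colorable.chromaticNumber_le
  · rw [← SimpleGraph.chromaticNumber_top (V := G)]
    refine SimpleGraph.chromaticNumber_mono_of_hom (G' := graphG3 G)
      ⟨fun g => (g, 1, 1), fun {a b} hab => ?_⟩
    rw [SimpleGraph.top_adj] at hab
    rw [graphG3, leftCayley, SimpleGraph.fromRel_adj]
    refine ⟨fun h => hab (congrArg Prod.fst h), Or.inl ⟨(b * a⁻¹, 1, 1), ⟨b * a⁻¹, ?_, ?_⟩, ?_⟩⟩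
    · exact fun h => hab (mul_inv_eq_one.mp h).symm
    · exact Or.inl rfl
    · simp

/-- Tight groups are closed under extensions. An element is written `x = k * s` with `k ∈ N` and `s`
the chosen representative of its coset; a translation by an element of `N` keeps `s` and
left-translates `k`, so the colours of the cosets and of the `N`-parts together separate. -/
theorem Tight.of_extension {G : Type*} [Group G] (N : Subgroup G) [N.Normal]
    (hN : Tight N) (hQ : Tight (G ⧸ N)) : Tight G := by
  classical
  obtain ⟨cN, hcN⟩ := hN
  obtain ⟨cQ, hcQ⟩ := hQ
  let q : G → G ⧸ N := fun x => (x : G ⧸ N)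
  have hk : ∀ x : G, x * (q x).out⁻¹ ∈ N := fun x => by
    rw [← QuotientGroup.eq_one_iff]
    simp [q]
  let k : G → N := fun x => ⟨x * (q x).out⁻¹, hk x⟩
  have hq : ∀ g x : G, q (g * x) = q g * q x := fun _ _ => rfl
  have hq1 : ∀ g ∈ N, ∀ x, q (g * x) = q x := fun g hg x => by
    rw [hq, show q g = 1 from (QuotientGroup.eq_one_iff g).mpr hg, one_mul]
  have hk1 : ∀ (g : G) (hg : g ∈ N) (x : G), k (g * x) = ⟨g, hg⟩ * k x := fun g hg x => by
    apply Subtype.ext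
    change g * x * (q (g * x)).out⁻¹ = g * (x * (q x).out⁻¹)
    rw [hq1 g hg, mul_assoc]
  have hc : IsProperOnCube (fun x y z : G => (cQ (q x) (q y) (q z), cN (k x) (k y) (k z))) := by
    intro g hg x y z
    by_cases hgN : g ∈ N
    · have h := hcN ⟨g, hgN⟩ (fun h => hg (congrArg Subtype.val h)) (k x) (k y) (k z)
      simp only [hk1 g hgN, ne_eq, Prod.mk.injEq, not_and]
      tauto
    · have h := hcQ (q g) (fun h => hgN ((QuotientGroup.eq_one_iff g).mp h)) (q x) (q y) (q z)
      simp only [hq, ne_eq, Prod.mk.injEq, not_and]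
      tauto
  exact hc.tight Subgroup.groupEquivQuotientProdSubgroup.symm

/-! ### Nilpotent groups of order prime to six -/

open scoped IsMulCommutative in
/-- In a commutative group of order prime to `6` the product `x * y * z` is a tight colouring: the
six directions multiply it by `g`, `g ^ 2` or `g ^ 3`. -/
theorem tight_of_isMulCommutative {G : Type*} [Group G] [IsMulCommutative G]
    (h6 : (Nat.card G).Coprime 6) : Tight G := by
  have hpow : ∀ n : ℕ, n ∣ 6 → ∀ g : G, g ≠ 1 → g ^ n ≠ 1 := fun n hn g hg h =>
    hg ((h6.coprime_dvd_right hn).pow_left_bijective.injective (by simpa using h))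
  refine ⟨fun x y z => x * y * z, fun g hg x y z => ?_⟩
  have h2 := hpow 2 (by norm_num) g hg
  have h3 := hpow 3 (by norm_num) g hg
  have key : ∀ (h : G) (w : G), h ≠ 1 → h * w ≠ w := fun h w hh e => hh (mul_eq_right.mp e)
  refine ⟨?_, ?_, ?_, ?_, ?_, ?_⟩
  · convert key g (x * y * z) hg using 1; dsimp only; ac_rfl
  · convert key g (x * y * z) hg using 1; dsimp only; ac_rfl
  · convert key g (x * y * z) hg using 1; dsimp only; ac_rfl
  · convert key (g ^ 2) (x * y * z) h2 using 1; rw [pow_two]; dsimp only; ac_rfl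
  · convert key (g ^ 2) (x * y * z) h2 using 1; rw [pow_two]; dsimp only; ac_rfl
  · convert key (g ^ 3) (x * y * z) h3 using 1; rw [pow_three]; dsimp only; ac_rfl

theorem tight_of_isNilpotent (G : Type*) [Group G] [Finite G] [hnil : Group.IsNilpotent G]
    (h6 : (Nat.card G).Coprime 6) : Tight G := by
  refine Group.nilpotent_center_quotient_ind
    (P := fun G _ _ => Finite G → (Nat.card G).Coprime 6 → Tight G) G ?_ ?_ ‹_› h6
  · intro G _ _ _ _
    exact tight_of_subsingleton G
  · intro G _ _ ih _ h6
    refine Tight.of_extension (Subgroup.center G) ?_ (ih inferInstance ?_)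
    · exact tight_of_isMulCommutative (h6.coprime_dvd_left (Subgroup.card_subgroup_dvd_card _))
    · exact h6.coprime_dvd_left (Subgroup.card_quotient_dvd_card _)

/-! ### The abelian groups `ℤ/3 × ℤ/3N` -/

/-- If `θ`, `θ - id` and `θ + id` are injective, then `(x, y, z) ↦ x + y - z + θ z` is a tight
colouring: along the six directions it changes by `g`, `g`, `Δ(θ - id)`, `2 g`, `Δθ` and
`Δ(θ + id)`. -/
theorem tight_of_strongCompleteMapping {A : Type*} [AddCommGroup A]
    (h2 : ∀ a : A, a + a = 0 → a = 0) (θ : A → A) (hθ : Function.Injective θ)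
    (hsub : Function.Injective fun a => θ a - a) (hadd : Function.Injective fun a => θ a + a) :
    Tight (Multiplicative A) := by
  have hc : IsProperOnCube (G := Multiplicative A) (C := A)
      (fun x y z => x.toAdd + y.toAdd - z.toAdd + θ z.toAdd) := by
    intro g hg x y z
    induction g using Multiplicative.rec with | _ g
    induction x using Multiplicative.rec with | _ x
    induction y using Multiplicative.rec with | _ y
    induction z using Multiplicative.rec with | _ z
    have hg' : g ≠ 0 := hg
    have hgz : g + z ≠ z := fun h => hg' (by simpa using h)
    simp only [toAdd_mul, toAdd_ofAdd]
    refine ⟨fun h => hg' ?_, fun h => hg' ?_, fun h => hgz (hsub ?_), fun h => hg' (h2 g ?_),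
      fun h => hgz (hθ ?_), fun h => hgz (hadd ?_)⟩
    · linear_combination (norm := abel) h
    · linear_combination (norm := abel) h
    · change θ (g + z) - (g + z) = θ z - z
      linear_combination (norm := abel) h
    · linear_combination (norm := abel) h
    · linear_combination (norm := abel) h
    · change θ (g + z) + (g + z) = θ z + z
      linear_combination (norm := abel) h
  exact hc.tight Multiplicative.ofAdd

/-- The sign function of period `N`, with value `1` at the multiples of `N` and `-1` elsewhere. -/
def stairSign (N m : ℕ) : ZMod 3 :=
  if m % N = 0 then 1 else -1

/-- A function modulo `3` that increases by `1` over each period `N` and whose increments are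
controlled by `stairSign`; see `stair_succ`. -/
def stair (N m : ℕ) : ZMod 3 :=
  ((m / N : ℕ) : ZMod 3) - if m % N = 0 then 0 else 1

theorem stairSign_mul_self (N m : ℕ) : stairSign N m * stairSign N m = 1 := by
  unfold stairSign
  split_ifs <;> decide

theorem stairSign_add_self (N m : ℕ) : stairSign N (m + N) = stairSign N m := by
  simp [stairSign]

theorem stair_add_self {N : ℕ} (hN : 0 < N) (m : ℕ) : stair N (m + N) = stair N m + 1 := by
  simp only [stair, Nat.add_div_right m hN, Nat.add_mod_right]
  push_cast
  ring

theorem stair_succ {N : ℕ} (hN : 0 < N) (m : ℕ) :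
    stair N (m + 1) = stair N m + stairSign N (m + 1) + stairSign N m - 1 := by
  have h3 : (3 : ZMod 3) = 0 := by decide
  obtain ⟨q, r, hr, rfl⟩ : ∃ q r, r < N ∧ m = N * q + r :=
    ⟨m / N, m % N, Nat.mod_lt _ hN, (Nat.div_add_mod m N).symm⟩
  have e1 : (N * q + r) / N = q := by
    rw [Nat.mul_add_div hN, Nat.div_eq_of_lt hr, add_zero]
  have e2 : (N * q + r) % N = r := by rw [Nat.mul_add_mod, Nat.mod_eq_of_lt hr]
  rcases Nat.lt_or_ge (r + 1) N with h | h
  · have e3 : (N * q + r + 1) / N = q := by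
      rw [add_assoc, Nat.mul_add_div hN, Nat.div_eq_of_lt h, add_zero]
    have e4 : (N * q + r + 1) % N = r + 1 := by
      rw [add_assoc, Nat.mul_add_mod, Nat.mod_eq_of_lt h]
    simp only [stair, stairSign, e1, e2, e3, e4]
    split_ifs <;> first | contradiction | omega | ring1 | linear_combination h3
  · obtain rfl : N = r + 1 := by omega
    have e3 : ((r + 1) * q + r + 1) / (r + 1) = q + 1 := by
      rw [add_assoc, Nat.mul_add_div hN, Nat.div_self hN]
    have e4 : ((r + 1) * q + r + 1) % (r + 1) = 0 := by
      rw [add_assoc, Nat.mul_add_mod, Nat.mod_self]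
    simp only [stair, stairSign, e1, e2, e3, e4]
    push_cast
    split_ifs <;> first | contradiction | omega | ring1 | linear_combination h3

theorem stairSign_mod (N m : ℕ) : stairSign N (m % (N * 3)) = stairSign N m := by
  simp only [stairSign, Nat.mod_mul_right_mod]

theorem stair_mod (N m : ℕ) : stair N (m % (N * 3)) = stair N m := by
  simp only [stair, Nat.mod_mul_right_mod, Nat.mod_mul_right_div_self]
  simp

/-- The representative of `i : ℤ/3` among `0`, `1`, `-1`, read modulo `n`. -/
def signedLift (n : ℕ) (i : ZMod 3) : ZMod n :=
  if i = 0 then 0 else if i = 1 then 1 else -1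

/-- The group `ℤ/3 × ℤ/3N` with `N` odd is tight. In the coordinates `(i, z)` with `z = q + i`,
where `i` is read as one of `0`, `1`, `-1`, the map `θ (i, q) = (stair z + i * stairSign z, 2 *
z)` is a strong complete mapping. Indeed, by `stair_succ`, `θ - id` is `(stair w - i * stairSign
w, w)` with `w = z + i`; the second coordinate `3 * z - i` of `θ + id` determines `i`, and `z` up
to a multiple of `N`, which `stair` detects. -/
theorem tight_zmod_three_prod {N : ℕ} (hN : Odd N) :
    Tight (Multiplicative (ZMod 3 × ZMod (N * 3))) := by
  have hN0 : 0 < N := hN.pos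
  have : NeZero (N * 3) := ⟨by omega⟩
  let s : ZMod 3 → ZMod (N * 3) := signedLift (N * 3)
  let σ : ZMod (N * 3) → ZMod 3 := fun z => stairSign N z.val
  let p : ZMod (N * 3) → ZMod 3 := fun z => stair N z.val
  have hσ : ∀ m : ℕ, σ (m : ZMod (N * 3)) = stairSign N m := fun m => by
    simp only [σ, ZMod.val_natCast, stairSign_mod]
  have hp : ∀ m : ℕ, p (m : ZMod (N * 3)) = stair N m := fun m => by
    simp only [p, ZMod.val_natCast, stair_mod]
  have hσσ : ∀ z, σ z * σ z = 1 := fun z => stairSign_mul_self N z.val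
  have hσN : ∀ z, σ (z + (N : ℕ)) = σ z := fun z => by
    obtain ⟨m, rfl⟩ := ZMod.natCast_zmod_surjective z
    rw [← Nat.cast_add, hσ, hσ, stairSign_add_self]
  have hpN : ∀ z, p (z + (N : ℕ)) = p z + 1 := fun z => by
    obtain ⟨m, rfl⟩ := ZMod.natCast_zmod_surjective z
    rw [← Nat.cast_add, hp, hp, stair_add_self hN0]
  have hp1 : ∀ z, p (z + 1) = p z + σ (z + 1) + σ z - 1 := fun z => by
    obtain ⟨m, rfl⟩ := ZMod.natCast_zmod_surjective z
    rw [← Nat.cast_succ, hp, hp, hσ, hσ, stair_succ hN0]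
  have h2 : ∀ a : ZMod (N * 3), a + a = 0 → a = 0 := fun a ha => by
    have hu : IsUnit ((2 : ℕ) : ZMod (N * 3)) := by
      rw [ZMod.isUnit_iff_coprime]
      exact (Nat.coprime_two_left.mpr (hN.mul (by decide)))
    refine hu.mul_left_cancel ?_
    push_cast
    linear_combination ha
  have h2' : ∀ a : ZMod 3, a + a = 0 → a = 0 := by decide
  let θ : ZMod 3 × ZMod (N * 3) → ZMod 3 × ZMod (N * 3) := fun a =>
    (p (a.2 + s a.1) + a.1 * σ (a.2 + s a.1), 2 * (a.2 + s a.1))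
  refine tight_of_strongCompleteMapping ?_ θ ?_ ?_ ?_
  · rintro ⟨a, b⟩ h
    rw [Prod.mk_add_mk, Prod.mk_eq_zero] at h
    rw [h2' a h.1, h2 b h.2, Prod.mk_zero_zero]
  · rintro ⟨i, q⟩ ⟨j, r⟩ h
    obtain ⟨h1, hz⟩ := Prod.mk.inj h
    dsimp only [θ] at h1 hz
    have hz : q + s i = r + s j := by
      have := h2 (q + s i - (r + s j)) (by linear_combination hz)
      linear_combination this
    rw [hz] at h1
    have hij : i = j := by
      linear_combination σ (r + s j) * h1 + (j - i) * hσσ (r + s j)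
    subst hij
    rw [add_right_cancel hz]
  · -- the first coordinate of `θ - id` in terms of `i` and `w = q + 2 * i`
    have key : ∀ (i : ZMod 3) (q : ZMod (N * 3)), p (q + s i) + i * σ (q + s i) - i =
        p (q + s i + s i) - i * σ (q + s i + s i) := by
      intro i q
      have hi : ∀ i : ZMod 3, i = 0 ∨ i = 1 ∨ i = -1 := by decide
      rcases hi i with rfl | rfl | rfl
      · simp [s, signedLift]
      · have e : s 1 = 1 := by simp [s, signedLift]
        rw [e, hp1 (q + 1)]
        ring
      · have e : s (-1) = -1 := by
          have : ¬ (-1 : ZMod 3) = 0 ∧ ¬ (-1 : ZMod 3) = 1 := by decide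
          simp only [s, signedLift, this.1, this.2, if_false]
        have h := hp1 (q + -1 + -1)
        rw [neg_add_cancel_right] at h
        rw [e, h]
        ring
    rintro ⟨i, q⟩ ⟨j, r⟩ h
    obtain ⟨h1, hw⟩ := Prod.mk.inj h
    dsimp only [θ] at h1 hw
    rw [key, key] at h1
    have hw : q + s i + s i = r + s j + s j := by linear_combination hw
    rw [hw] at h1
    have hij : i = j := by
      linear_combination -σ (r + s j + s j) * h1 + (j - i) * hσσ (r + s j + s j)
    subst hij
    rw [add_right_cancel (add_right_cancel hw)]
  · rintro ⟨i, q⟩ ⟨j, r⟩ h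
    obtain ⟨h1, hz⟩ := Prod.mk.inj h
    dsimp only [θ] at h1 hz
    have hij : i = j := by
      let f : ZMod (N * 3) →+* ZMod 3 := ZMod.castHom (Dvd.intro_left N rfl) (ZMod 3)
      have hf : ∀ i, f (s i) = i := by
        intro i
        simp only [s, signedLift]
        split_ifs with h0 h1
        · rw [map_zero, h0]
        · rw [map_one, h1]
        · rw [map_neg, map_one]
          revert i
          decide
      have h3 : (3 : ZMod 3) = 0 := by decide
      have := congrArg f hz
      simp only [map_add, map_mul, map_ofNat, hf] at this
      linear_combination -this + (f q + i - f r - j) * h3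
    subst hij
    -- `q` and `r` differ by a multiple of `N`
    have hd : ∃ t : ℕ, t < 3 ∧ q = r + (t * N : ℕ) := by
      obtain ⟨m, hm⟩ := ZMod.natCast_zmod_surjective (q - r)
      have h0 : ((3 * m : ℕ) : ZMod (N * 3)) = 0 := by
        push_cast
        rw [hm]
        linear_combination hz
      rw [ZMod.natCast_eq_zero_iff, mul_comm 3 m] at h0
      obtain ⟨u, rfl⟩ := Nat.dvd_of_mul_dvd_mul_right (by norm_num) h0
      refine ⟨u % 3, Nat.mod_lt _ (by norm_num), ?_⟩
      have e : ((u % 3 * N : ℕ) : ZMod (N * 3)) = ((N * u : ℕ) : ZMod (N * 3)) := by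
        rw [ZMod.natCast_eq_natCast_iff, mul_comm N u, mul_comm N 3]
        exact Nat.ModEq.mul_right' N (Nat.mod_modEq u 3)
      rw [e, hm]
      ring
    have hpt : ∀ (t : ℕ) (z : ZMod (N * 3)), p (z + (t * N : ℕ)) = p z + t ∧
        σ (z + (t * N : ℕ)) = σ z := by
      intro t z
      induction t with
      | zero => simp
      | succ t ih =>
        rw [Nat.succ_mul, Nat.cast_add, ← add_assoc, hpN, hσN, ih.1, ih.2]
        push_cast
        exact ⟨by ring, rfl⟩
    obtain ⟨t, ht, rfl⟩ := hd
    rw [add_right_comm r _ (s i), (hpt t _).1, (hpt t _).2] at h1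
    have ht0 : (t : ZMod 3) = 0 := by linear_combination h1
    rw [ZMod.natCast_eq_zero_iff] at ht0
    obtain rfl : t = 0 := Nat.eq_zero_of_dvd_of_lt ht0 ht
    simp

/-- The internal form of `tight_zmod_three_prod`: commuting elements of orders `3` and `3N` whose
cyclic groups meet trivially generate a tight subgroup. -/
theorem exists_tight_subgroup {G : Type*} [Group G] {N : ℕ} (hN : Odd N) {v w : G}
    (hv : v ^ 3 = 1) (hw : orderOf w = N * 3) (hvw : Commute v w)
    (hmem : v ∉ Subgroup.zpowers w) :
    ∃ H : Subgroup G, Tight H ∧ Nat.card H = N * 9 ∧ H = Subgroup.closure {v, w} := by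
  have : NeZero (N * 3) := ⟨by have := hN.pos; omega⟩
  have hw' : w ^ (N * 3) = 1 := hw ▸ pow_orderOf_eq_one w
  let f : Multiplicative (ZMod 3 × ZMod (N * 3)) →* G :=
    { toFun := fun a => v ^ a.toAdd.1.val * w ^ a.toAdd.2.val
      map_one' := by simp
      map_mul' := by
        intro a b
        simp only [toAdd_mul, Prod.fst_add, Prod.snd_add, ZMod.val_add]
        rw [← pow_eq_pow_mod _ hv, ← pow_eq_pow_mod _ hw', pow_add, pow_add,
          mul_assoc, mul_assoc, ← mul_assoc (v ^ _) (w ^ _) (w ^ _), (hvw.pow_pow _ _).eq,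
          mul_assoc] }
  have hf : ∀ (i : ZMod 3) (q : ZMod (N * 3)),
      f (Multiplicative.ofAdd (i, q)) = v ^ i.val * w ^ q.val := fun _ _ => rfl
  have hinj : Function.Injective f := by
    rw [injective_iff_map_eq_one]
    intro a ha
    induction a using Multiplicative.rec with | _ a
    obtain ⟨i, q⟩ := a
    rw [hf] at ha
    have hi : i = 0 := by
      have hvi : v ^ i.val ∈ Subgroup.zpowers w := by
        rw [eq_inv_of_mul_eq_one_left ha]
        exact inv_mem (Subgroup.npow_mem_zpowers w _)
      have hcop : ∀ i : ZMod 3, i ≠ 0 → (3 * (i.val / 2) + 1) = i.val * i.val := by decide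
      by_contra hi
      apply hmem
      have := pow_mem hvi i.val
      rwa [← pow_mul, ← hcop i hi, pow_succ, pow_mul, hv, one_pow, one_mul] at this
    subst hi
    rw [ZMod.val_zero, pow_zero, one_mul] at ha
    have hq : q = 0 := by
      rw [← ZMod.val_eq_zero]
      exact Nat.eq_zero_of_dvd_of_lt (hw.symm.dvd.trans (orderOf_dvd_of_pow_eq_one ha)) q.val_lt
    rw [hq]
    rfl
  refine ⟨f.range, (tight_zmod_three_prod hN).of_mulEquiv (MonoidHom.ofInjective hinj), ?_, ?_⟩
  · rw [← Nat.card_congr (MonoidHom.ofInjective hinj).toEquiv]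
    simp only [Nat.card_congr Multiplicative.toAdd, Nat.card_prod, Nat.card_zmod]
    ring
  · apply le_antisymm
    · rintro _ ⟨a, rfl⟩
      exact mul_mem (pow_mem (Subgroup.subset_closure (by simp)) _)
        (pow_mem (Subgroup.subset_closure (by simp)) _)
    · rw [Subgroup.closure_le]
      have h1 : (1 : ZMod (N * 3)).val = 1 := ZMod.val_one'' (by omega)
      rintro _ (rfl | rfl)
      · exact ⟨Multiplicative.ofAdd (1, 0), by
          rw [hf, ZMod.val_zero, pow_zero, mul_one]
          exact pow_one _⟩
      · exact ⟨Multiplicative.ofAdd (0, 1), by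
          rw [hf, h1, pow_one, ZMod.val_zero, pow_zero, one_mul]⟩

/-! ### The groups of order 27 -/

/-- If `x * y = κ * (y * x)` with `κ` commuting with `x` and `y`, moving `x ^ m` past `y ^ n` costs
`κ ^ (m * n)`. -/
theorem pow_mul_pow_eq_of_commute {G : Type*} [Group G] {x y κ : G} (hx : Commute κ x)
    (hy : Commute κ y) (h : x * y = κ * (y * x)) (m n : ℕ) :
    x ^ m * y ^ n = κ ^ (m * n) * (y ^ n * x ^ m) := by
  have h1 : SemiconjBy x y (κ * y) := by rw [SemiconjBy, h, mul_assoc]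
  have hm : ∀ m : ℕ, SemiconjBy (x ^ m) y (κ ^ m * y) := by
    intro m
    induction m with
    | zero => simp
    | succ m ih =>
      have h2 : SemiconjBy x (κ ^ m * y) (κ ^ m * (κ * y)) :=
        SemiconjBy.mul_right ((hx.pow_left m).symm) h1
      rw [← mul_assoc, ← pow_succ] at h2
      rw [pow_succ' x m]
      exact SemiconjBy.mul_left h2 ih
  have := (hm m).pow_right n
  rw [(hy.pow_left m).mul_pow, ← pow_mul] at this
  rw [this.eq, mul_assoc]

/-- Cubing respects products of two elements whose commutator is central in the subgroup they
generate and has order dividing `3`. -/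
theorem mul_pow_three_of_commute {G : Type*} [Group G] {x y κ : G} (hx : Commute κ x)
    (hy : Commute κ y) (h3 : κ ^ 3 = 1) (h : x * y = κ * (y * x)) :
    (y * x) ^ 3 = y ^ 3 * x ^ 3 := by
  have h1 := pow_mul_pow_eq_of_commute hx hy h 1 1
  have h2 := pow_mul_pow_eq_of_commute hx hy h 2 1
  simp only [pow_one, mul_one] at h1 h2
  calc (y * x) ^ 3 = y * (x * y) * x * (y * x) := by simp only [pow_three, mul_assoc]
    _ = y * (κ * (y * x)) * x * (y * x) := by rw [h]
    _ = κ * (y * y * (x ^ 2 * y) * x) := by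
      simp only [pow_two, ← mul_assoc]
      rw [hy.eq]
    _ = κ * (y * y * (κ ^ 2 * (y * x ^ 2)) * x) := by rw [h2]
    _ = κ * κ ^ 2 * (y * y * y * x ^ 2 * x) := by
      have : Commute (κ ^ 2) (y * y) := (hy.mul_right hy).pow_left 2
      have e : κ * y * y * κ ^ 2 = κ * κ ^ 2 * y * y := by
        rw [mul_assoc κ y y, mul_assoc κ (y * y), ← this.eq]
        simp only [mul_assoc]
      simp only [← mul_assoc]
      rw [e]
    _ = y ^ 3 * x ^ 3 := by
      rw [← pow_succ', h3, one_mul, pow_succ x 2, pow_three' y, ← mul_assoc]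

/-- The carry of the addition of two ternary digits. -/
def ternaryCarry (a b : ZMod 3) : ZMod 3 :=
  if 3 ≤ a.val + b.val then 1 else 0

/-- The product of `k ^ u₃ * y ^ u₂ * x ^ u₁` and `k ^ v₃ * y ^ v₂ * x ^ v₁` in coordinates, in a
group where `k` is central, `k ^ 3 = x ^ 3 = 1`, `y ^ 3 = k ^ ε₂` and `x * y = k ^ ε₁ * y * x`. -/
def coordMul (ε₁ ε₂ : ZMod 3) (u v : ZMod 3 × ZMod 3 × ZMod 3) : ZMod 3 × ZMod 3 × ZMod 3 :=
  (u.1 + v.1, u.2.1 + v.2.1,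
    u.2.2 + v.2.2 + ε₁ * (u.1 * v.2.1) + ε₂ * ternaryCarry u.2.1 v.2.1)

/-- The analogue of `IsProperOnCube` for `coordMul`. -/
def IsProperOnCoord (ε₁ ε₂ : ZMod 3)
    (c : (ZMod 3 × ZMod 3 × ZMod 3) → (ZMod 3 × ZMod 3 × ZMod 3) → (ZMod 3 × ZMod 3 × ZMod 3) →
      (ZMod 3 × ZMod 3 × ZMod 3)) : Prop :=
  ∀ g, g ≠ 0 → ∀ x y z,
    c (coordMul ε₁ ε₂ g x) y z ≠ c x y z ∧ c x (coordMul ε₁ ε₂ g y) z ≠ c x y z ∧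
    c x y (coordMul ε₁ ε₂ g z) ≠ c x y z ∧
    c (coordMul ε₁ ε₂ g x) (coordMul ε₁ ε₂ g y) z ≠ c x y z ∧
    c x (coordMul ε₁ ε₂ g y) (coordMul ε₁ ε₂ g z) ≠ c x y z ∧
    c (coordMul ε₁ ε₂ g x) (coordMul ε₁ ε₂ g y) (coordMul ε₁ ε₂ g z) ≠ c x y z

theorem zero_coordMul (ε₁ ε₂ : ZMod 3) (u : ZMod 3 × ZMod 3 × ZMod 3) :
    coordMul ε₁ ε₂ 0 u = u := by
  have : ternaryCarry 0 u.2.1 = 0 := by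
    rw [ternaryCarry, if_neg]
    simpa using u.2.1.val_lt
  simp [coordMul, this]

/-- A colouring whose change under left translations only depends on the middle coordinates has to
be tested only at points with vanishing outer coordinates. -/
theorem isProperOnCoord_of_reduction {ε₁ ε₂ : ZMod 3}
    {c : (ZMod 3 × ZMod 3 × ZMod 3) → (ZMod 3 × ZMod 3 × ZMod 3) → (ZMod 3 × ZMod 3 × ZMod 3) →
      (ZMod 3 × ZMod 3 × ZMod 3)}
    (hred : ∀ a b d x y z, c (coordMul ε₁ ε₂ a x) (coordMul ε₁ ε₂ b y) (coordMul ε₁ ε₂ d z) =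
        c x y z →
      c (coordMul ε₁ ε₂ a (0, x.2.1, 0)) (coordMul ε₁ ε₂ b (0, y.2.1, 0))
        (coordMul ε₁ ε₂ d (0, z.2.1, 0)) = c (0, x.2.1, 0) (0, y.2.1, 0) (0, z.2.1, 0))
    (htest : ∀ g, g ≠ 0 → ∀ r s t : ZMod 3,
      c (coordMul ε₁ ε₂ g (0, r, 0)) (0, s, 0) (0, t, 0) ≠ c (0, r, 0) (0, s, 0) (0, t, 0) ∧
      c (0, r, 0) (coordMul ε₁ ε₂ g (0, s, 0)) (0, t, 0) ≠ c (0, r, 0) (0, s, 0) (0, t, 0) ∧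
      c (0, r, 0) (0, s, 0) (coordMul ε₁ ε₂ g (0, t, 0)) ≠ c (0, r, 0) (0, s, 0) (0, t, 0) ∧
      c (coordMul ε₁ ε₂ g (0, r, 0)) (coordMul ε₁ ε₂ g (0, s, 0)) (0, t, 0) ≠
        c (0, r, 0) (0, s, 0) (0, t, 0) ∧
      c (0, r, 0) (coordMul ε₁ ε₂ g (0, s, 0)) (coordMul ε₁ ε₂ g (0, t, 0)) ≠
        c (0, r, 0) (0, s, 0) (0, t, 0) ∧
      c (coordMul ε₁ ε₂ g (0, r, 0)) (coordMul ε₁ ε₂ g (0, s, 0)) (coordMul ε₁ ε₂ g (0, t, 0)) ≠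
        c (0, r, 0) (0, s, 0) (0, t, 0)) :
    IsProperOnCoord ε₁ ε₂ c := by
  intro g hg x y z
  obtain ⟨t1, t2, t3, t4, t5, t6⟩ := htest g hg x.2.1 y.2.1 z.2.1
  refine ⟨fun h => t1 ?_, fun h => t2 ?_, fun h => t3 ?_, fun h => t4 ?_, fun h => t5 ?_,
    fun h => t6 (hred g g g x y z h)⟩
  · simpa only [zero_coordMul] using hred g 0 0 x y z (by simpa only [zero_coordMul] using h)
  · simpa only [zero_coordMul] using hred 0 g 0 x y z (by simpa only [zero_coordMul] using h)
  · simpa only [zero_coordMul] using hred 0 0 g x y z (by simpa only [zero_coordMul] using h)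
  · simpa only [zero_coordMul] using hred g g 0 x y z (by simpa only [zero_coordMul] using h)
  · simpa only [zero_coordMul] using hred 0 g g x y z (by simpa only [zero_coordMul] using h)

/-- A colouring for the elementary abelian group of order `27`. -/
theorem isProperOnCoord_elementary : IsProperOnCoord 0 0 (fun x y z =>
    (x.1 - z.1 - z.2.2 + z.2.1 + y.2.1, x.2.2 + y.2.2 + z.1 + z.2.2 + z.2.1,
      y.1 - y.2.2 + z.2.2 - x.2.1)) := by
  refine isProperOnCoord_of_reduction ?_ ?_
  · intro a b d x y z h
    simp only [coordMul, Prod.mk.injEq] at h ⊢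
    obtain ⟨h1, h2, h3⟩ := h
    exact ⟨by linear_combination h1, by linear_combination h2, by linear_combination h3⟩
  · decide +kernel

/-- A colouring for the non-abelian group of order `27` and exponent `3`. -/
theorem isProperOnCoord_heisenberg : IsProperOnCoord 1 0 (fun x y z =>
    (x.1 - y.2.2 - z.2.2, x.2.2 - z.1 + z.2.1 + y.2.1,
      y.1 + y.2.2 - z.1 + z.2.2 + y.2.1 - x.2.1)) := by
  refine isProperOnCoord_of_reduction ?_ ?_
  · intro a b d x y z h
    simp only [coordMul, Prod.mk.injEq] at h ⊢
    obtain ⟨h1, h2, h3⟩ := h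
    exact ⟨by linear_combination h1, by linear_combination h2, by linear_combination h3⟩
  · decide +kernel

/-- A colouring for the non-abelian group of order `27` and exponent `9`. -/
theorem isProperOnCoord_extraspecial : IsProperOnCoord 1 1 (fun x y z =>
    (x.1 + z.1 - y.2.1, x.2.2 - y.2.2 - z.2.2 - y.2.1 - x.2.1 ^ 2 * y.2.1,
      -y.1 + y.2.2 + z.1 - z.2.2 - z.2.1 - y.2.1 ^ 2 * z.2.1 + x.2.1)) := by
  refine isProperOnCoord_of_reduction ?_ ?_
  · intro a b d x y z h
    simp only [coordMul, Prod.mk.injEq] at h ⊢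
    obtain ⟨h1, h2, h3⟩ := h
    exact ⟨by linear_combination h1, by linear_combination h2, by linear_combination h3⟩
  · decide +kernel

/-- A group of order `27` with the presentation described at `coordMul` is tight as soon as
`coordMul` admits a proper colouring. -/
theorem tight_of_card_twentySeven {G : Type*} [Group G] {ε₁ ε₂ : ZMod 3} {x y k : G}
    (hG : Nat.card G = 27) (hgen : Subgroup.closure {x, y, k} = ⊤) (hk : ∀ g, Commute k g)
    (hk3 : k ^ 3 = 1) (hx3 : x ^ 3 = 1) (hy3 : y ^ 3 = k ^ ε₂.val)
    (hxy : x * y = k ^ ε₁.val * (y * x))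
    {c : (ZMod 3 × ZMod 3 × ZMod 3) → (ZMod 3 × ZMod 3 × ZMod 3) → (ZMod 3 × ZMod 3 × ZMod 3) →
      (ZMod 3 × ZMod 3 × ZMod 3)} (hc : IsProperOnCoord ε₁ ε₂ c) : Tight G := by
  have : Finite G := Nat.finite_of_card_ne_zero (by omega)
  have hadd : ∀ {w : G}, w ^ 3 = 1 → ∀ a b : ZMod 3, w ^ (a + b).val = w ^ a.val * w ^ b.val := by
    intro w hw a b
    rw [ZMod.val_add, ← pow_eq_pow_mod _ hw, pow_add]
  have hmul : ∀ a b : ZMod 3, k ^ (a * b).val = k ^ (a.val * b.val) := by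
    intro a b
    rw [ZMod.val_mul, ← pow_eq_pow_mod _ hk3]
  have hcarry : ∀ a b : ZMod 3, y ^ a.val * y ^ b.val =
      k ^ (ε₂ * ternaryCarry a b).val * y ^ (a + b).val := by
    intro a b
    have e : ∀ a b : ZMod 3, a.val + b.val = 3 * (ternaryCarry a b).val + (a + b).val := by decide
    rw [← pow_add, e, pow_add, pow_mul, hy3, ← pow_mul, hmul]
  have hcomm : ∀ a b : ZMod 3, x ^ a.val * y ^ b.val =
      k ^ (ε₁ * (a * b)).val * (y ^ b.val * x ^ a.val) := by
    intro a b
    rw [pow_mul_pow_eq_of_commute ((hk x).pow_left _) ((hk y).pow_left _) hxy, ← pow_mul, hmul,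
      ZMod.val_mul a b, pow_mul k, pow_mul k]
    congr 1
    rw [← pow_eq_pow_mod]
    rw [← pow_mul, mul_comm, pow_mul, hk3, one_pow]
  let ψ : ZMod 3 × ZMod 3 × ZMod 3 → G := fun u => k ^ u.2.2.val * (y ^ u.2.1.val * x ^ u.1.val)
  have hψ : ∀ u v, ψ (coordMul ε₁ ε₂ u v) = ψ u * ψ v := by
    intro u v
    have h1 : ∀ (n : ℕ) (g : G), g * k ^ n = k ^ n * g := fun n g => ((hk g).pow_left n).eq.symm
    have h2 : ∀ (n : ℕ) (g h : G), g * (k ^ n * h) = k ^ n * (g * h) := fun n g h => by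
      rw [← mul_assoc, h1, mul_assoc]
    calc ψ (coordMul ε₁ ε₂ u v)
        = k ^ u.2.2.val * (k ^ v.2.2.val * (k ^ (ε₁ * (u.1 * v.2.1)).val *
          (k ^ (ε₂ * ternaryCarry u.2.1 v.2.1).val *
            (y ^ (u.2.1 + v.2.1).val * (x ^ u.1.val * x ^ v.1.val))))) := by
          simp only [ψ, coordMul, hadd hk3, hadd hx3, mul_assoc]
      _ = k ^ u.2.2.val * (k ^ v.2.2.val * (k ^ (ε₁ * (u.1 * v.2.1)).val *
          (y ^ u.2.1.val * y ^ v.2.1.val * (x ^ u.1.val * x ^ v.1.val)))) := by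
          rw [hcarry]; simp only [mul_assoc]
      _ = k ^ u.2.2.val * (k ^ v.2.2.val * (y ^ u.2.1.val *
          (x ^ u.1.val * y ^ v.2.1.val * x ^ v.1.val))) := by
          rw [hcomm]; simp only [mul_assoc]; rw [h2 _ (y ^ u.2.1.val)]
      _ = ψ u * ψ v := by
          simp only [ψ, mul_assoc]
          rw [h2 _ (x ^ u.1.val), h2 _ (y ^ u.2.1.val)]
  have hψ0 : ψ 0 = 1 := by simp [ψ]
  have hclosed : ∀ g : G, (∃ u, ψ u = g) := by
    let M : Submonoid G :=
      { carrier := Set.range ψ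
        one_mem' := ⟨0, hψ0⟩
        mul_mem' := by
          rintro _ _ ⟨u, rfl⟩ ⟨v, rfl⟩
          exact ⟨_, hψ u v⟩ }
    have hM : M = ⊤ := by
      rw [eq_top_iff, ← Subgroup.top_toSubmonoid, ← hgen,
        Subgroup.closure_toSubmonoid_of_finite, Submonoid.closure_le]
      have v1 : (1 : ZMod 3).val = 1 := rfl
      rintro _ (rfl | rfl | rfl)
      · exact ⟨(1, 0, 0), by simp [ψ, v1]⟩
      · exact ⟨(0, 1, 0), by simp [ψ, v1]⟩
      · exact ⟨(0, 0, 1), by simp [ψ, v1]⟩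
    intro g
    have : g ∈ M := hM ▸ Submonoid.mem_top g
    exact this
  have hbij : Function.Bijective ψ :=
    Function.Surjective.bijective_of_nat_card_le hclosed (by simp [hG])
  let e : ZMod 3 × ZMod 3 × ZMod 3 ≃ G := Equiv.ofBijective ψ hbij
  have he : ∀ g w : G, e.symm (g * w) = coordMul ε₁ ε₂ (e.symm g) (e.symm w) := by
    intro g w
    rw [Equiv.symm_apply_eq]
    change _ = ψ _
    rw [hψ]
    change _ = e _ * e _
    simp
  have hc' : IsProperOnCube (fun x y z => c (e.symm x) (e.symm y) (e.symm z)) := by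
    intro g hg x y z
    have hg' : e.symm g ≠ 0 := by
      rw [ne_eq, Equiv.symm_apply_eq]
      exact fun h => hg (h.trans hψ0)
    simpa only [he] using hc (e.symm g) hg' (e.symm x) (e.symm y) (e.symm z)
  exact hc'.tight e

/-! ### Subgroups with elementary abelian quotient of order nine -/

section ThreeGroups

open scoped commutatorElement

/-- `K` contains all cubes and all commutators and has index `9`; that is, `K` is normal with
quotient isomorphic to `ℤ/3 × ℤ/3`. -/
structure HasElementaryQuotient {G : Type*} [Group G] (K : Subgroup G) : Prop where
  index_eq : K.index = 9
  pow_three_mem : ∀ x : G, x ^ 3 ∈ K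
  commutator_mem : ∀ x y : G, ⁅x, y⁆ ∈ K

theorem HasElementaryQuotient.normal {G : Type*} [Group G] {K : Subgroup G}
    (hK : HasElementaryQuotient K) : K.Normal :=
  ⟨fun n hn g => by
    have := mul_mem (hK.commutator_mem g n) hn
    rwa [commutatorElement_def, inv_mul_cancel_right] at this⟩

theorem Tight.of_eq_top {G : Type*} [Group G] {H : Subgroup G} (hH : Tight H) (h : H = ⊤) :
    Tight G := by
  subst h
  exact hH.of_mulEquiv Subgroup.topEquiv

theorem HasElementaryQuotient.tight {G : Type*} [Group G] {K : Subgroup G}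
    (hK : HasElementaryQuotient K) (hT : Tight K) : Tight G := by
  have := hK.normal
  refine Tight.of_extension K hT ?_
  have hcard : Nat.card (G ⧸ K) = 9 := hK.index_eq
  have : Finite (G ⧸ K) := Nat.finite_of_card_ne_zero (by omega)
  have h3 : ∀ x : G ⧸ K, x ^ 3 = 1 := fun x => by
    obtain ⟨x, rfl⟩ := QuotientGroup.mk_surjective x
    rw [← QuotientGroup.mk_pow, QuotientGroup.eq_one_iff]
    exact hK.pow_three_mem x
  have hcomm : ∀ x y : G ⧸ K, Commute x y := fun x y => by
    obtain ⟨x, rfl⟩ := QuotientGroup.mk_surjective x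
    obtain ⟨y, rfl⟩ := QuotientGroup.mk_surjective y
    rw [← commutatorElement_eq_one_iff_commute]
    exact (QuotientGroup.eq_one_iff _).mpr (hK.commutator_mem x y)
  have : Nontrivial (G ⧸ K) := Finite.one_lt_card_iff_nontrivial.mp (by omega)
  obtain ⟨w, hw⟩ := exists_ne (1 : G ⧸ K)
  have how : orderOf w = 1 * 3 := by rw [one_mul, orderOf_eq_prime (h3 w) hw]
  obtain ⟨v, hv⟩ : ∃ v, v ∉ Subgroup.zpowers w := by
    by_contra! h
    have := Nat.card_zpowers w
    rw [(Subgroup.eq_top_iff' _).mpr h, Subgroup.card_top] at this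
    omega
  obtain ⟨H, hT, hH, -⟩ := exists_tight_subgroup odd_one (h3 v) how (hcomm v w) hv
  exact hT.of_eq_top (Subgroup.eq_top_of_card_eq H (by omega))

/-- A group with an elementary abelian quotient of order `9` by a subgroup containing `N` has
non-cyclic quotient by `N`. -/
theorem HasElementaryQuotient.not_isCyclic_quotient {G : Type*} [Group G] {K N : Subgroup G}
    [N.Normal] (hK : HasElementaryQuotient K) (hN : N ≤ K) : ¬ IsCyclic (G ⧸ N) := by
  rintro ⟨g, hg⟩
  have := hK.normal
  obtain ⟨g, rfl⟩ := QuotientGroup.mk_surjective g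
  have htop : Subgroup.zpowers (g : G ⧸ K) = ⊤ := by
    rw [Subgroup.eq_top_iff']
    intro x
    obtain ⟨x, rfl⟩ := QuotientGroup.mk_surjective x
    obtain ⟨n, hn⟩ := hg x
    refine ⟨n, ?_⟩
    dsimp only at hn ⊢
    rw [← QuotientGroup.mk_zpow, QuotientGroup.eq] at hn ⊢
    exact hN hn
  have h3 : (g : G ⧸ K) ^ 3 = 1 := by
    rw [← QuotientGroup.mk_pow, QuotientGroup.eq_one_iff]
    exact hK.pow_three_mem g
  have h := Nat.card_zpowers (g : G ⧸ K)
  rw [htop, Subgroup.card_top] at h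
  have h9 : Nat.card (G ⧸ K) = 9 := hK.index_eq
  have := orderOf_le_of_pow_eq_one (by norm_num) h3
  omega

theorem IsPGroup.index_eq_of_isCoatom {p : ℕ} [Fact p.Prime] {G : Type*} [Group G] [Finite G]
    (hG : IsPGroup p G) {M : Subgroup G} (hM : IsCoatom M) : M.index = p := by
  obtain ⟨n, hn⟩ := IsPGroup.iff_card.mp hG
  obtain ⟨m, hm⟩ := IsPGroup.iff_card.mp (hG.to_subgroup M)
  have hlt : Nat.card M < Nat.card G := by
    refine lt_of_le_of_ne (Subgroup.card_le_card_group M) fun h => hM.1 ?_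
    exact Subgroup.eq_top_of_card_eq M h
  rw [hn, hm, Nat.pow_lt_pow_iff_right (Nat.Prime.one_lt Fact.out)] at hlt
  obtain ⟨K, hK, hMK⟩ := Sylow.exists_subgroup_card_pow_succ
    (hn ▸ pow_dvd_pow p hlt : p ^ (m + 1) ∣ Nat.card G) hm
  have hne : M ≠ K := by
    rintro rfl
    rw [hm] at hK
    exact absurd (Nat.pow_right_injective (Nat.Prime.two_le Fact.out) hK) (by omega)
  rw [hM.2 K (lt_of_le_of_ne hMK hne), Subgroup.card_top, pow_succ, ← hm,
    ← M.card_mul_index] at hK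
  exact Nat.eq_of_mul_eq_mul_left Nat.card_pos hK

/-- Two distinct maximal subgroups of a non-cyclic `3`-group meet in a subgroup with elementary
abelian quotient of order `9`. -/
theorem IsPGroup.exists_hasElementaryQuotient {G : Type*} [Group G] [Finite G] (hG : IsPGroup 3 G)
    (hcyc : ¬ IsCyclic G) : ∃ K : Subgroup G, HasElementaryQuotient K := by
  have hnt : Nontrivial G := by
    by_contra h
    rw [not_nontrivial_iff_subsingleton] at h
    exact hcyc inferInstance
  have hnil := hG.isNilpotent
  have hnormal : ∀ M : Subgroup G, IsCoatom M → M.Normal := fun M hM =>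
    Subgroup.NormalizerCondition.normal_of_coatom M Group.normalizerCondition_of_isNilpotent hM
  obtain ⟨M₁, hM₁, -⟩ := (eq_top_or_exists_le_coatom (⊥ : Subgroup G)).resolve_left bot_ne_top
  obtain ⟨x, hx⟩ : ∃ x, x ∉ M₁ := by
    by_contra! h
    exact hM₁.1 ((Subgroup.eq_top_iff' _).mpr h)
  obtain ⟨M₂, hM₂, hxM₂⟩ := (eq_top_or_exists_le_coatom (Subgroup.zpowers x)).resolve_left
    fun h => hcyc ⟨x, fun y => (h ▸ Subgroup.mem_top y : y ∈ Subgroup.zpowers x)⟩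
  have n₁ := hnormal M₁ hM₁
  have n₂ := hnormal M₂ hM₂
  have i₁ := hG.index_eq_of_isCoatom hM₁
  have i₂ := hG.index_eq_of_isCoatom hM₂
  have hcomm : ∀ M : Subgroup G, M.Normal → M.index = 3 → ∀ x y : G, ⁅x, y⁆ ∈ M := by
    intro M _ hM x y
    have : Fact (Nat.Prime 3) := ⟨Nat.prime_three⟩
    have : IsCyclic (G ⧸ M) := isCyclic_of_prime_card (p := 3) hM
    rw [← QuotientGroup.eq_one_iff]
    change ⁅(x : G ⧸ M), (y : G ⧸ M)⁆ = 1
    rw [commutatorElement_eq_one_iff_mul_comm]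
    exact mul_comm' _ _
  refine ⟨M₁ ⊓ M₂, ?_, fun y => ⟨?_, ?_⟩, fun y z => ⟨hcomm M₁ n₁ i₁ y z, hcomm M₂ n₂ i₂ y z⟩⟩
  · have h1 : (M₁ ⊓ M₂).relIndex M₁ = 3 := by
      rw [Subgroup.inf_relIndex_left]
      have hd : M₂.relIndex M₁ ∣ 3 := i₂ ▸ Subgroup.relIndex_dvd_index_of_normal M₂ M₁
      refine ((Nat.dvd_prime Nat.prime_three).mp hd).resolve_left fun h => ?_
      rw [Subgroup.relIndex_eq_one] at h
      rcases h.eq_or_lt with h | h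
      · exact hx (h ▸ hxM₂ (Subgroup.mem_zpowers x))
      · exact hM₂.1 (hM₁.2 _ h)
    rw [← Subgroup.relIndex_mul_index (inf_le_left : M₁ ⊓ M₂ ≤ M₁), h1, i₁]
  · exact i₁ ▸ M₁.pow_index_mem y
  · exact i₂ ▸ M₂.pow_index_mem y

end ThreeGroups

/-! ### Cyclic subgroups with elementary abelian quotient -/

/-- The factorization `s ^ 3 - 1 = (s - 1) * (s ^ 2 + s + 1)`, whose second factor is divisible by
`3` exactly once when the first one is divisible by `3`. -/
theorem Int.three_pow_dvd_sub_one {s : ℤ} {i : ℕ} (h : (3 : ℤ) ^ (i + 1) ∣ s ^ 3 - 1) :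
    3 ∣ s - 1 ∧ (3 : ℤ) ^ i ∣ s - 1 := by
  have h3 : (3 : ℤ) ∣ s - 1 := by
    have h1 : (3 : ℤ) ∣ s ^ 3 - 1 := (dvd_pow_self 3 (Nat.succ_ne_zero i)).trans h
    have h2 : (3 : ℤ) ∣ (s - 1) ^ 3 := by
      have : (s - 1) ^ 3 = s ^ 3 - 1 + 3 * (-s ^ 2 + s) := by ring
      rw [this]
      exact dvd_add h1 (dvd_mul_right _ _)
    exact Int.prime_three.dvd_of_dvd_pow h2
  refine ⟨h3, ?_⟩
  obtain ⟨t, ht⟩ := h3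
  obtain rfl : s = 1 + 3 * t := by linarith
  have e : (1 + 3 * t) ^ 3 - 1 = (1 + 3 * (t + t ^ 2)) * (3 * (3 * t)) := by ring
  have hcop : IsCoprime ((3 : ℤ) ^ (i + 1)) (1 + 3 * (t + t ^ 2)) :=
    IsCoprime.pow_left ⟨-(t + t ^ 2), 1, by ring⟩
  rw [e, pow_succ'] at h
  rw [pow_succ'] at hcop
  have h := (mul_dvd_mul_iff_left (by norm_num)).mp (hcop.dvd_of_dvd_mul_left h)
  simpa using h

section ThreeGroups

open scoped commutatorElement

/-- An element that normalizes `⟨k⟩`, of order `3 ^ (i + 1)`, and whose cube centralizes `k`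
moves `k` by an element of the subgroup of order `3`, and centralizes that subgroup: it acts as
`k ↦ k ^ s` with `s ^ 3 ≡ 1`, which forces `s ≡ 1` modulo `3` and modulo `3 ^ i`. -/
theorem commutatorElement_mem_zpowers_pow {G : Type*} [Group G] {x k : G} {i : ℕ}
    (hk : orderOf k = 3 ^ (i + 1)) (hx : x * k * x⁻¹ ∈ Subgroup.zpowers k)
    (h3 : Commute (x ^ 3) k) :
    ⁅x, k⁆ ∈ Subgroup.zpowers (k ^ 3 ^ i) ∧ Commute x (k ^ 3 ^ i) := by
  obtain ⟨s, hs⟩ := hx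
  dsimp only at hs
  have hconj : ∀ n : ℤ, x * k ^ n * x⁻¹ = k ^ (s * n) := fun n => by
    rw [← conj_zpow, ← hs, zpow_mul]
  have hs3 : (3 : ℤ) ^ (i + 1) ∣ s ^ 3 - 1 := by
    have h1 : x ^ 3 * k * (x ^ 3)⁻¹ = k ^ (s ^ 3) := by
      calc x ^ 3 * k * (x ^ 3)⁻¹ = x * (x * (x * k ^ (1 : ℤ) * x⁻¹) * x⁻¹) * x⁻¹ := by
            simp only [pow_three, mul_inv_rev, mul_assoc, zpow_one]
        _ = k ^ (s ^ 3) := by rw [hconj, hconj, hconj]; congr 1; ring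
    rw [h3.eq, mul_inv_cancel_right] at h1
    have : (orderOf k : ℤ) ∣ s ^ 3 - 1 := by
      rw [orderOf_dvd_iff_zpow_eq_one, zpow_sub_one, ← h1, mul_inv_cancel]
    rw [hk] at this
    exact_mod_cast this
  obtain ⟨⟨t, ht⟩, ⟨e, he⟩⟩ := Int.three_pow_dvd_sub_one hs3
  constructor
  · refine ⟨e, ?_⟩
    dsimp only
    rw [commutatorElement_def, ← hs, ← zpow_sub_one, he, zpow_mul]
    norm_cast
  · have h := hconj ((3 : ℤ) ^ i)
    have e1 : k ^ ((3 : ℤ) ^ i) = k ^ 3 ^ i := by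
      rw [← zpow_natCast]
      norm_cast
    have e2 : k ^ (s * (3 : ℤ) ^ i) = k ^ 3 ^ i := by
      have : s * (3 : ℤ) ^ i = 3 ^ i + (3 ^ (i + 1) : ℕ) * t := by
        push_cast
        linear_combination (3 : ℤ) ^ i * ht
      rw [this, zpow_add, zpow_mul, zpow_natCast, ← hk, pow_orderOf_eq_one, one_zpow, mul_one, e1]
    rw [e1, e2] at h
    exact mul_inv_eq_iff_eq_mul.mp h

theorem exists_pow_val_of_mem_zpowers {G : Type*} [Group G] {k c : G} (hk : k ^ 3 = 1)
    (hc : c ∈ Subgroup.zpowers k) : ∃ e : ZMod 3, c = k ^ e.val := by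
  obtain ⟨n, rfl⟩ := hc
  refine ⟨(n : ZMod 3), ?_⟩
  dsimp only
  have h : k ^ (3 : ℤ) = 1 := by exact_mod_cast hk
  rw [← zpow_natCast, ZMod.val_intCast, zpow_eq_zpow_emod n h]
  rfl

theorem Commute.of_closure_eq_top {G : Type*} [Group G] {S : Set G} {k : G}
    (hS : Subgroup.closure S = ⊤) (h : ∀ s ∈ S, Commute k s) (g : G) : Commute k g := by
  have : Subgroup.closure S ≤ Subgroup.centralizer {k} := by
    rw [Subgroup.closure_le]
    exact fun s hs => Subgroup.mem_centralizer_singleton_iff.mpr (h s hs).eq.symm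
  exact (Subgroup.mem_centralizer_singleton_iff.mp (this (hS ▸ Subgroup.mem_top g))).symm

theorem Subgroup.eq_top_of_lt_of_index_eq_prime {G : Type*} [Group G] {H L : Subgroup G} {p : ℕ}
    (hp : p.Prime) (hH : H.index = p) (h : H < L) : L = ⊤ := by
  rw [← Subgroup.index_eq_one]
  have h1 := Subgroup.relIndex_mul_index h.le
  rw [hH] at h1
  refine ((Nat.dvd_prime hp).mp (Dvd.intro_left _ h1)).resolve_right fun h2 => ?_
  rw [h2] at h1
  have h3 : H.relIndex L = 1 := Nat.eq_of_mul_eq_mul_right hp.pos (by rw [h1, one_mul])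
  exact not_le_of_gt h (Subgroup.relIndex_eq_one.mp h3)

/-- Groups of order `27` and exponent `3`, in the form met below. -/
theorem tight_of_exponent_three {G : Type*} [Group G] {k : G} (hk : orderOf k = 3)
    (hK : HasElementaryQuotient (Subgroup.zpowers k)) (hcube : ∀ x : G, x ^ 3 = 1) : Tight G := by
  have hk3 : k ^ 3 = 1 := hcube k
  have hcard : Nat.card G = 27 := by
    rw [← (Subgroup.zpowers k).card_mul_index, hK.index_eq, Nat.card_zpowers, hk]
  have : Finite G := Nat.finite_of_card_ne_zero (by omega)
  have hcentral : ∀ g, Commute k g := fun g => by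
    have h := (commutatorElement_mem_zpowers_pow (x := g) (k := k) (i := 0) (by simpa using hk)
      (hK.normal.conj_mem _ (Subgroup.mem_zpowers k) g)
      (by rw [hcube]; exact Commute.one_left k)).2
    simpa using h.symm
  obtain ⟨x, hx⟩ : ∃ x, x ∉ Subgroup.zpowers k := by
    by_contra! h
    have := hK.index_eq
    rw [(Subgroup.eq_top_iff' _).mpr h, Subgroup.index_top] at this
    omega
  obtain ⟨H, -, hHcard, rfl⟩ := exists_tight_subgroup odd_one (hcube x) (by simpa using hk)
    (hcentral x).symm hx
  have hHindex : (Subgroup.closure {x, k}).index = 3 := by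
    have := (Subgroup.closure {x, k}).card_mul_index
    rw [hHcard, hcard] at this
    omega
  obtain ⟨y, hy⟩ : ∃ y, y ∉ Subgroup.closure {x, k} := by
    by_contra! h
    rw [(Subgroup.eq_top_iff' _).mpr h, Subgroup.index_top] at hHindex
    omega
  have hgen : Subgroup.closure {x, y, k} = ⊤ := by
    refine Subgroup.eq_top_of_lt_of_index_eq_prime Nat.prime_three hHindex
      (lt_of_le_of_ne (Subgroup.closure_mono ?_) fun h => hy ?_)
    · rintro _ (rfl | rfl) <;> simp
    · rw [h]
      exact Subgroup.subset_closure (by simp)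
  have hgen' : Subgroup.closure {y, x, k} = ⊤ := by rwa [Set.insert_comm]
  have hy3 : ∀ g : G, g ^ 3 = k ^ (0 : ZMod 3).val := fun g => by rw [hcube]; simp
  obtain ⟨e, he⟩ := exists_pow_val_of_mem_zpowers hk3 (hK.commutator_mem x y)
  have hxy : x * y = k ^ e.val * (y * x) := by
    rw [← he, commutatorElement_def]
    group
  have hcases : ∀ e : ZMod 3, e = 0 ∨ e = 1 ∨ e = 2 := by decide
  rcases hcases e with rfl | rfl | rfl
  · exact tight_of_card_twentySeven hcard hgen hcentral hk3 (hcube x) (hy3 y) hxy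
      isProperOnCoord_elementary
  · exact tight_of_card_twentySeven hcard hgen hcentral hk3 (hcube x) (hy3 y) hxy
      isProperOnCoord_heisenberg
  · -- exchanging the two generators inverts the commutator
    refine tight_of_card_twentySeven hcard hgen' hcentral hk3 (hcube y) (hy3 x) ?_
      isProperOnCoord_heisenberg
    have v1 : (1 : ZMod 3).val = 1 := rfl
    have v2 : (2 : ZMod 3).val = 2 := rfl
    rw [hxy, v1, v2, pow_one, ← mul_assoc, ← pow_succ', hk3, one_mul]

/-- The case of a cyclic subgroup `⟨k⟩` of order at least `9` in which no cube is a generator. Then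
`k ^ 3` is central, the commutators form a central subgroup of order `3`, and an element outside
`⟨k⟩` can be corrected by a power of `k` to have order `3`. With `k ^ 3` it generates an abelian
non-cyclic subgroup whose quotient is elementary abelian again. -/
theorem tight_of_pow_three_mem {G : Type*} [Group G] {k : G} {i : ℕ}
    (hk : orderOf k = 3 ^ (i + 2)) (hK : HasElementaryQuotient (Subgroup.zpowers k))
    (hcube : ∀ x : G, x ^ 3 ∈ Subgroup.zpowers (k ^ 3)) : Tight G := by
  have hcard : Nat.card G = 3 ^ (i + 2) * 9 := by
    rw [← (Subgroup.zpowers k).card_mul_index, hK.index_eq, Nat.card_zpowers, hk]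
  have hk3 : Subgroup.zpowers (k ^ 3) ≤ Subgroup.zpowers k :=
    Subgroup.zpowers_le.mpr (Subgroup.npow_mem_zpowers k 3)
  have hkk : ∀ u ∈ Subgroup.zpowers k, ∀ v ∈ Subgroup.zpowers k, Commute u v := by
    rintro _ ⟨m, rfl⟩ _ ⟨n, rfl⟩
    exact Commute.zpow_zpow_self k m n
  obtain ⟨ζ, hζ⟩ : ∃ ζ, ζ = k ^ 3 ^ (i + 1) := ⟨_, rfl⟩
  have hζ3 : ζ ^ 3 = 1 := by rw [hζ, ← pow_mul, ← pow_succ, ← hk, pow_orderOf_eq_one]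
  have hζk3 : Subgroup.zpowers ζ ≤ Subgroup.zpowers (k ^ 3) := by
    rw [hζ, pow_succ', pow_mul]
    exact Subgroup.zpowers_le.mpr (Subgroup.npow_mem_zpowers _ _)
  have hcub1 : ∀ d ∈ Subgroup.zpowers ζ, d ^ 3 = 1 := by
    rintro _ ⟨n, rfl⟩
    dsimp only
    rw [← zpow_natCast, zpow_comm, zpow_natCast, hζ3, one_zpow]
  have hact : ∀ x : G, ⁅x, k⁆ ∈ Subgroup.zpowers ζ ∧ Commute x ζ := fun x => hζ ▸
    commutatorElement_mem_zpowers_pow hk (hK.normal.conj_mem _ (Subgroup.mem_zpowers k) x)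
      (hkk _ (hk3 (hcube x)) _ (Subgroup.mem_zpowers k))
  have hconj : ∀ x : G, x * k * x⁻¹ = ⁅x, k⁆ * k := fun x => by
    rw [commutatorElement_def, inv_mul_cancel_right]
  have hdk : ∀ x : G, Commute ⁅x, k⁆ k := fun x =>
    hkk _ (hk3 (hζk3 (hact x).1)) _ (Subgroup.mem_zpowers k)
  have hcentral : ∀ x : G, ∀ w ∈ Subgroup.zpowers (k ^ 3), Commute x w := by
    rintro x _ ⟨n, rfl⟩
    refine Commute.zpow_right (mul_inv_eq_iff_eq_mul.mp ?_) n
    rw [← conj_pow, hconj, (hdk x).mul_pow, hcub1 _ (hact x).1, one_mul]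
  have hcomm : ∀ x y : G, ⁅x, y⁆ ∈ Subgroup.zpowers ζ := by
    intro x y
    obtain ⟨n, hn⟩ := hK.commutator_mem x y
    dsimp only at hn
    obtain ⟨D, hD⟩ : ∃ D, D = ⁅x, k⁆ ^ n := ⟨_, rfl⟩
    have hDmem : D ∈ Subgroup.zpowers ζ := hD ▸ zpow_mem (hact x).1 n
    have hDx : x * D * x⁻¹ = D := mul_inv_eq_iff_eq_mul.mpr (hcentral x D (hζk3 hDmem)).eq
    have hDc : Commute D (k ^ n) := hkk _ (hk3 (hζk3 hDmem)) _ (Subgroup.zpow_mem_zpowers k n)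
    have hcx : x * k ^ n * x⁻¹ = D * k ^ n := by
      rw [← conj_zpow, hconj, (hdk x).mul_zpow, hD]
    have hyx : x * y * x⁻¹ = k ^ n * y := by
      rw [hn, commutatorElement_def, inv_mul_cancel_right]
    have h3 : x ^ 3 * y * (x ^ 3)⁻¹ = D ^ 3 * (k ^ n) ^ 3 * y := by
      calc x ^ 3 * y * (x ^ 3)⁻¹ = x * (x * (x * y * x⁻¹) * x⁻¹) * x⁻¹ := by
            simp only [pow_three, mul_inv_rev, mul_assoc]
        _ = x * (x * (k ^ n * y) * x⁻¹) * x⁻¹ := by rw [hyx]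
        _ = x * (x * k ^ n * x⁻¹ * (x * y * x⁻¹)) * x⁻¹ := by group
        _ = x * (D * k ^ n * (k ^ n * y)) * x⁻¹ := by rw [hcx, hyx]
        _ = x * D * x⁻¹ * (x * k ^ n * x⁻¹) * (x * k ^ n * x⁻¹) * (x * y * x⁻¹) := by group
        _ = D * (D * k ^ n) * (D * k ^ n) * (k ^ n * y) := by rw [hDx, hcx, hyx]
        _ = D * (D * k ^ n * (D * k ^ n)) * (k ^ n * y) := by simp only [mul_assoc]
        _ = D * (D ^ 2 * (k ^ n) ^ 2) * (k ^ n * y) := by rw [← pow_two, hDc.mul_pow]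
        _ = D ^ 3 * (k ^ n) ^ 3 * y := by
            rw [pow_succ' D 2, pow_succ (k ^ n) 2]; simp only [mul_assoc]
    rw [← (hcentral y _ (hcube x)).eq, mul_inv_cancel_right, hcub1 D hDmem, one_mul] at h3
    have h4 : k ^ (n * 3) = 1 := by
      rw [zpow_mul]
      exact_mod_cast mul_eq_right.mp h3.symm
    rw [← orderOf_dvd_iff_zpow_eq_one, hk, pow_succ] at h4
    push_cast at h4
    obtain ⟨t, rfl⟩ := (mul_dvd_mul_iff_right (by norm_num)).mp h4
    have e1 : k ^ ((3 : ℤ) ^ (i + 1)) = ζ := by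
      rw [hζ, ← zpow_natCast]
      norm_cast
    rw [← hn, zpow_mul, e1]
    exact Subgroup.zpow_mem_zpowers ζ t
  obtain ⟨x, hx⟩ : ∃ x, x ∉ Subgroup.zpowers k := by
    by_contra! h
    have := hK.index_eq
    rw [(Subgroup.eq_top_iff' _).mpr h, Subgroup.index_top] at this
    omega
  obtain ⟨n, hn⟩ := hcube x
  dsimp only at hn
  have hy3 : (x * k ^ (-n)) ^ 3 = 1 := by
    have hκ := hcomm (k ^ (-n)) x
    rw [mul_pow_three_of_commute (hcentral _ _ (hζk3 hκ)).symm (hcentral _ _ (hζk3 hκ)).symm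
      (hcub1 _ hκ) (by rw [commutatorElement_def]; group), ← hn]
    group
  have hy : x * k ^ (-n) ∉ Subgroup.zpowers k := fun h =>
    hx ((Subgroup.mul_mem_cancel_right _ (Subgroup.zpow_mem_zpowers k (-n))).mp h)
  have how : orderOf (k ^ 3) = 3 ^ i * 3 := by
    rw [orderOf_pow_of_dvd (by norm_num) (hk ▸ dvd_pow_self 3 (by omega)), hk, pow_succ,
      Nat.mul_div_cancel _ (by norm_num), pow_succ]
  obtain ⟨H, hT, hHcard, hH⟩ := exists_tight_subgroup (Odd.pow (by decide)) hy3 how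
    (hcentral _ _ (Subgroup.mem_zpowers _)) (fun h => hy (hk3 h))
  have hle : Subgroup.zpowers (k ^ 3) ≤ H := by
    rw [Subgroup.zpowers_le, hH]
    exact Subgroup.subset_closure (by simp)
  refine HasElementaryQuotient.tight (K := H) ⟨?_, fun g => hle (hcube g), fun g h =>
    hle (hζk3 (hcomm g h))⟩ hT
  have h := H.card_mul_index
  rw [hHcard, hcard, pow_succ, pow_succ] at h
  refine Nat.eq_of_mul_eq_mul_left (show 0 < 3 ^ i * 9 by positivity) ?_
  rw [h]
  ring

end ThreeGroups

/-! ### Three-groups with a cyclic subgroup of index three -/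

/-- `G` has the generators, relations and order of `groupL r`. -/
def IsModular (G : Type*) [Group G] (r : ℕ) : Prop :=
  Nat.card G = 3 ^ r ∧ ∃ a b : G, orderOf a = 3 ^ (r - 1) ∧ b ^ 3 = 1 ∧
    b * a * b⁻¹ = a ^ (1 + 3 ^ (r - 2)) ∧ Subgroup.closure {a, b} = ⊤

theorem tight_or_isModular_of_generators {G : Type*} [Group G] {a b : G} {j : ℕ}
    (hcard : Nat.card G = 3 ^ (j + 3)) (ha : orderOf a = 3 ^ (j + 2)) (hb : b ^ 3 = 1)
    (hab : b * a * b⁻¹ = a ^ (1 + 3 ^ (j + 1))) (hgen : Subgroup.closure {a, b} = ⊤) :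
    Tight G ∨ ∃ r, 4 ≤ r ∧ IsModular G r := by
  rcases Nat.eq_zero_or_pos j with rfl | hj
  · left
    have hba : b * a = a ^ 3 * (a * b) := by
      rw [← mul_assoc, ← pow_succ, mul_inv_eq_iff_eq_mul.mp hab]
      norm_num
    have hcomm : Commute (a ^ 3) b := by
      have h1 : a ^ 9 = 1 := by rw [← pow_orderOf_eq_one a, ha]; norm_num
      have h : b * a ^ 3 * b⁻¹ = a ^ 3 := by
        rw [← conj_pow, hab, ← pow_mul, show (1 + 3 ^ (0 + 1)) * 3 = 9 + 3 by norm_num, pow_add,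
          h1, one_mul]
      exact (mul_inv_eq_iff_eq_mul.mp h).symm
    have v1 : (1 : ZMod 3).val = 1 := rfl
    have hgen' : Subgroup.closure {b, a, a ^ 3} = ⊤ := by
      rw [eq_top_iff, ← hgen]
      refine Subgroup.closure_mono ?_
      rintro _ (rfl | rfl) <;> simp
    refine tight_of_card_twentySeven (x := b) (y := a) (k := a ^ 3) (by simpa using hcard) hgen'
      (Commute.of_closure_eq_top hgen ?_) ?_ hb ?_ ?_ isProperOnCoord_extraspecial
    · rintro c (hc | hc)
      · rw [hc]
        exact Commute.pow_self a 3
      · rw [hc]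
        exact hcomm
    · rw [← pow_mul, ← pow_orderOf_eq_one a, ha]
      norm_num
    · rw [v1, pow_one]
    · rw [v1, pow_one, hba]
  · right
    refine ⟨j + 3, by omega, hcard, a, b, ha, hb, ?_, hgen⟩
    exact hab

section ThreeGroups

open scoped commutatorElement

/-- The `3`-groups with a cyclic subgroup `⟨a⟩` of index `3` and order at least `9`: an element
outside `⟨a⟩` can be corrected by a power of `a` to an element `b` with `b ^ 3 = 1`, and `b` moves
`a` by an element of the subgroup of order `3` of `⟨a⟩`. If the two commute, the group is abelian,
and otherwise it is modular up to replacing `b` by its inverse. -/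
theorem tight_or_isModular_of_cyclic {G : Type*} [Group G] {a : G} {j : ℕ}
    (ha : orderOf a = 3 ^ (j + 2)) (hK : HasElementaryQuotient (Subgroup.zpowers (a ^ 3))) :
    Tight G ∨ ∃ r, 4 ≤ r ∧ IsModular G r := by
  have ha3 : orderOf (a ^ 3) = 3 ^ (j + 1) := by
    rw [orderOf_pow_of_dvd (by norm_num) (ha ▸ dvd_pow_self 3 (by omega)), ha, pow_succ,
      Nat.mul_div_cancel _ (by norm_num)]
  have hcard : Nat.card G = 3 ^ (j + 3) := by
    rw [← (Subgroup.zpowers (a ^ 3)).card_mul_index, hK.index_eq, Nat.card_zpowers, ha3]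
    ring
  have hindex : (Subgroup.zpowers a).index = 3 := by
    have := (Subgroup.zpowers a).card_mul_index
    rw [Nat.card_zpowers, ha, hcard, pow_succ _ (j + 2)] at this
    exact Nat.eq_of_mul_eq_mul_left (by positivity) this
  have hle : Subgroup.zpowers (a ^ 3) ≤ Subgroup.zpowers a :=
    Subgroup.zpowers_le.mpr (Subgroup.npow_mem_zpowers a 3)
  have haa : ∀ u ∈ Subgroup.zpowers a, Commute u a := by
    rintro _ ⟨m, rfl⟩
    exact Commute.zpow_self a m
  obtain ⟨x, hx⟩ : ∃ x, x ∉ Subgroup.zpowers a := by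
    by_contra! h
    rw [(Subgroup.eq_top_iff' _).mpr h, Subgroup.index_top] at hindex
    omega
  obtain ⟨ζ, hζ⟩ : ∃ ζ, ζ = a ^ 3 ^ (j + 1) := ⟨_, rfl⟩
  have hζ3 : ζ ^ 3 = 1 := by rw [hζ, ← pow_mul, ← pow_succ, ← ha, pow_orderOf_eq_one]
  have hζa : Commute ζ a := hζ ▸ Commute.pow_self a _
  obtain ⟨hxa, hxζ⟩ : ⁅x, a⁆ ∈ Subgroup.zpowers ζ ∧ Commute x ζ := hζ ▸
    commutatorElement_mem_zpowers_pow ha (by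
      have := mul_mem (hle (hK.commutator_mem x a)) (Subgroup.mem_zpowers a)
      rwa [commutatorElement_def, inv_mul_cancel_right] at this)
      (haa _ (hle (hK.pow_three_mem x)))
  obtain ⟨e, he⟩ := exists_pow_val_of_mem_zpowers hζ3 hxa
  have hconj : x * a * x⁻¹ = ζ ^ e.val * a := by
    rw [← he, commutatorElement_def, inv_mul_cancel_right]
  obtain ⟨n, hn⟩ := hK.pow_three_mem x
  dsimp only at hn
  -- the corrected element
  obtain ⟨b, hb⟩ : ∃ b, b = x * a ^ (-n) := ⟨_, rfl⟩
  have hbmem : b ∉ Subgroup.zpowers a := fun h =>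
    hx ((Subgroup.mul_mem_cancel_right _ (Subgroup.zpow_mem_zpowers a (-n))).mp (hb ▸ h))
  have hbζ : Commute b ζ := by
    rw [hb]
    exact hxζ.mul_left (hζa.zpow_right _).symm
  have hb3 : b ^ 3 = 1 := by
    have h1 : x * a ^ (-n) * x⁻¹ = (ζ ^ e.val) ^ (-n) * a ^ (-n) := by
      rw [← conj_zpow, hconj, (hζa.pow_left _).mul_zpow]
    have h2 : a ^ (-n) * x = (ζ ^ e.val) ^ n * (x * a ^ (-n)) := by
      rw [mul_inv_eq_iff_eq_mul.mp h1]
      group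
    have hc1 : Commute ((ζ ^ e.val) ^ n) (a ^ (-n)) := ((hζa.pow_left _).zpow_left n).zpow_right _
    have hc2 : Commute ((ζ ^ e.val) ^ n) x := (hxζ.symm.pow_left _).zpow_left n
    rw [hb, mul_pow_three_of_commute hc1 hc2 ?_ h2, ← hn]
    · group
    · have h : (ζ ^ e.val) ^ 3 = 1 := by rw [← pow_mul, mul_comm, pow_mul, hζ3, one_pow]
      rw [← zpow_natCast, zpow_comm, zpow_natCast, h, one_zpow]
  have hba : b * a * b⁻¹ = ζ ^ e.val * a := by
    rw [← hconj, hb]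
    group
  have hgen : ∀ b ∉ Subgroup.zpowers a, Subgroup.closure {a, b} = ⊤ := by
    intro b hb
    refine Subgroup.eq_top_of_lt_of_index_eq_prime Nat.prime_three hindex
      (lt_of_le_of_ne ?_ fun h => hb ?_)
    · exact Subgroup.zpowers_le.mpr (Subgroup.subset_closure (by simp))
    · rw [h]
      exact Subgroup.subset_closure (by simp)
  have hcases : ∀ e : ZMod 3, e = 0 ∨ e = 1 ∨ e = 2 := by decide
  have v1 : (1 : ZMod 3).val = 1 := rfl
  have v2 : (2 : ZMod 3).val = 2 := rfl
  have hζa' : ζ * a = a ^ (1 + 3 ^ (j + 1)) := by rw [hζ, ← pow_succ, add_comm]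
  rcases hcases e with rfl | rfl | rfl
  · rw [ZMod.val_zero, pow_zero, one_mul] at hba
    obtain ⟨H, hT, hHcard, -⟩ := exists_tight_subgroup (N := 3 ^ (j + 1)) (Odd.pow (by decide)) hb3
      (by rw [ha, pow_succ]) (mul_inv_eq_iff_eq_mul.mp hba) hbmem
    have : Finite G := Nat.finite_of_card_ne_zero (by rw [hcard]; positivity)
    exact Or.inl (hT.of_eq_top (Subgroup.eq_top_of_card_eq H (by rw [hHcard, hcard]; ring)))
  · rw [v1, pow_one, hζa'] at hba
    exact tight_or_isModular_of_generators hcard ha hb3 hba (hgen b hbmem)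
  · rw [v2] at hba
    refine tight_or_isModular_of_generators (b := b⁻¹) hcard ha (by rw [inv_pow, hb3, inv_one]) ?_
      (hgen _ fun h => hbmem (inv_mem_iff.mp h))
    have h1 : b⁻¹ * (ζ ^ 2 * a) * b⁻¹⁻¹ = a := by rw [← hba]; group
    have h2 : b⁻¹ * ζ ^ 2 = ζ ^ 2 * b⁻¹ := ((hbζ.pow_right 2).inv_left).eq
    rw [← mul_assoc, h2, mul_assoc, mul_assoc] at h1
    rw [← hζa', mul_assoc, eq_inv_mul_of_mul_eq h1]
    congr 1
    rw [inv_eq_iff_mul_eq_one, ← pow_succ, hζ3]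

end ThreeGroups

/-! ### The modular groups -/

/-- The normal form `a ^ u * b ^ v` in a group generated by `a` and `b` with `b` normalizing the
powers of `a`. -/
theorem exists_eq_pow_mul_pow {G : Type*} [Group G] {a b : G} {m n s : ℕ} (hm : 0 < m) (hn : 0 < n)
    (ha : a ^ m = 1) (hb : b ^ n = 1) (hab : b * a * b⁻¹ = a ^ s)
    (hgen : Subgroup.closure {a, b} = ⊤) (x : G) :
    ∃ u < m, ∃ v < n, x = a ^ u * b ^ v := by
  suffices h : ∃ u v : ℕ, x = a ^ u * b ^ v by
    obtain ⟨u, v, rfl⟩ := h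
    exact ⟨u % m, Nat.mod_lt _ hm, v % n, Nat.mod_lt _ hn, by
      rw [← pow_eq_pow_mod u ha, ← pow_eq_pow_mod v hb]⟩
  have hleft : ∀ c, c = a ∨ c = b → ∀ k : ℕ, ∀ y : G, (∃ u v : ℕ, y = a ^ u * b ^ v) →
      ∃ u v : ℕ, c ^ k * y = a ^ u * b ^ v := by
    intro c hc k
    induction k with
    | zero => intro y hy; simpa using hy
    | succ k ih =>
      intro y hy
      rw [pow_succ, mul_assoc]
      refine ih _ ?_
      obtain ⟨u, v, rfl⟩ := hy
      rcases hc with rfl | rfl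
      · exact ⟨u + 1, v, by rw [pow_succ', mul_assoc]⟩
      · refine ⟨s * u, v + 1, ?_⟩
        have : c * a ^ u * c⁻¹ = a ^ (s * u) := by rw [← conj_pow, hab, pow_mul]
        rw [← this, pow_succ' c v]
        group
  have hx : x ∈ Subgroup.closure {a, b} := hgen ▸ Subgroup.mem_top x
  have hinv : ∀ c, c = a ∨ c = b → ∃ k : ℕ, c⁻¹ = c ^ k := by
    rintro c (rfl | rfl)
    · exact ⟨m - 1, inv_eq_of_mul_eq_one_left (by rw [← pow_succ, Nat.sub_add_cancel hm, ha])⟩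
    · exact ⟨n - 1, inv_eq_of_mul_eq_one_left (by rw [← pow_succ, Nat.sub_add_cancel hn, hb])⟩
  induction hx using Subgroup.closure_induction_left with
  | one => exact ⟨0, 0, by simp⟩
  | mul_left c hc y _ ih =>
    have := hleft c hc 1 y ih
    rwa [pow_one] at this
  | inv_mul_cancel c hc y _ ih =>
    obtain ⟨k, hk⟩ := hinv c hc
    rw [hk]
    exact hleft c hc k y ih

theorem IsModular.nonempty_mulEquiv_groupL {G : Type*} [Group G] {r : ℕ} (hr : 4 ≤ r)
    (hG : IsModular G r) : Nonempty (G ≃* groupL r) := by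
  obtain ⟨hcard, a, b, ha, hb, hab, hgen⟩ := hG
  have hrel : ∀ w ∈ relatorsL r, FreeGroup.lift ![a, b] w = 1 := by
    rintro w (rfl | rfl | rfl)
    · simp [← ha, pow_orderOf_eq_one]
    · simpa using hb
    · simpa [mul_inv_eq_one] using hab
  let F : groupL r →* G := PresentedGroup.toGroup hrel
  let a' : groupL r := PresentedGroup.of 0
  let b' : groupL r := PresentedGroup.of 1
  have hFa : F a' = a := by simp [F, a']
  have hFb : F b' = b := by simp [F, b']
  have hFsurj : Function.Surjective F := by
    rw [← MonoidHom.range_eq_top, eq_top_iff, ← hgen, Subgroup.closure_le]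
    rintro _ (rfl | rfl)
    · exact ⟨a', hFa⟩
    · exact ⟨b', hFb⟩
  have ha' : a' ^ 3 ^ (r - 1) = 1 := by
    have := PresentedGroup.one_of_mem (rels := relatorsL r) (x := FreeGroup.of 0 ^ 3 ^ (r - 1))
      (Or.inl rfl)
    rw [map_pow] at this
    exact this
  have hb' : b' ^ 3 = 1 := by
    have := PresentedGroup.one_of_mem (rels := relatorsL r) (x := FreeGroup.of 1 ^ 3)
      (Or.inr (Or.inl rfl))
    rw [map_pow] at this
    exact this
  have hab' : b' * a' * b'⁻¹ = a' ^ (1 + 3 ^ (r - 2)) := by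
    have := PresentedGroup.one_of_mem (rels := relatorsL r)
      (x := (FreeGroup.of 1 * FreeGroup.of 0 * (FreeGroup.of 1)⁻¹) *
        (FreeGroup.of 0 ^ (1 + 3 ^ (r - 2)))⁻¹) (Or.inr (Or.inr rfl))
    simp only [map_mul, map_inv, map_pow] at this
    exact mul_inv_eq_one.mp this
  have hgen' : Subgroup.closure {a', b'} = ⊤ := by
    rw [eq_top_iff, ← PresentedGroup.closure_range_of (relatorsL r)]
    refine Subgroup.closure_mono ?_
    rintro _ ⟨i, rfl⟩
    fin_cases i
    · exact Or.inl rfl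
    · exact Or.inr rfl
  let N : Fin (3 ^ (r - 1)) × Fin 3 → groupL r := fun p => a' ^ p.1.val * b' ^ p.2.val
  have hN : Function.Surjective N := fun x => by
    obtain ⟨u, hu, v, hv, rfl⟩ := exists_eq_pow_mul_pow (by positivity) (by norm_num) ha' hb' hab'
      hgen' x
    exact ⟨(⟨u, hu⟩, ⟨v, hv⟩), rfl⟩
  have : Finite (groupL r) := Finite.of_surjective N hN
  have hle : Nat.card (groupL r) ≤ Nat.card G := by
    have := Nat.card_le_card_of_surjective N hN
    rw [hcard]
    simpa [← pow_succ, show r - 1 + 1 = r by omega] using this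
  exact ⟨(MulEquiv.ofBijective F (hFsurj.bijective_of_nat_card_le hle)).symm⟩

/-- A modular group has a characteristic tight subgroup of index `3`, namely `⟨a ^ 3, b⟩`: it is
abelian, and it consists of the elements whose order divides `3 ^ (r - 2)`. -/
theorem IsModular.exists_characteristic {G : Type*} [Group G] {r : ℕ} (hr : 4 ≤ r)
    (hG : IsModular G r) : ∃ H : Subgroup G, H.Characteristic ∧ Tight H ∧ H.index = 3 := by
  obtain ⟨t, rfl⟩ : ∃ t, r = t + 4 := ⟨r - 4, by omega⟩
  obtain ⟨hcard, a, b, ha, hb, hab, hgen⟩ := hG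
  change orderOf a = 3 ^ (t + 3) at ha
  change b * a * b⁻¹ = a ^ (1 + 3 ^ (t + 2)) at hab
  have ha1 : a ^ 3 ^ (t + 3) = 1 := ha ▸ pow_orderOf_eq_one a
  obtain ⟨ζ, hζ⟩ : ∃ ζ, ζ = a ^ 3 ^ (t + 2) := ⟨_, rfl⟩
  have hζ3 : ζ ^ 3 = 1 := by rw [hζ, ← pow_mul, ← pow_succ, ha1]
  have hζa : Commute ζ a := hζ ▸ Commute.pow_self a _
  have hconj : b * a * b⁻¹ = ζ * a := by rw [hab, hζ, ← pow_succ, add_comm]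
  have hcomm3 : Commute b (a ^ 3) := by
    refine mul_inv_eq_iff_eq_mul.mp ?_
    rw [← conj_pow, hconj, hζa.mul_pow, hζ3, one_mul]
  have hζb : Commute ζ b := by
    rw [hζ, pow_succ', pow_mul]
    exact (hcomm3.pow_right _).symm
  have hnotmem : b ∉ Subgroup.zpowers a := by
    intro h
    have h1 : Subgroup.zpowers a = ⊤ := by
      rw [eq_top_iff, ← hgen, Subgroup.closure_le]
      rintro _ (rfl | rfl)
      · exact Subgroup.mem_zpowers _
      · exact h
    have h2 := Nat.card_zpowers a
    rw [h1, Subgroup.card_top, hcard, ha] at h2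
    exact absurd (Nat.pow_right_injective (le_of_lt (by norm_num : 2 < 3)) h2) (by omega)
  have how : orderOf (a ^ 3) = 3 ^ (t + 1) * 3 := by
    rw [orderOf_pow_of_dvd (by norm_num) (ha ▸ dvd_pow_self 3 (by omega)), ha, pow_succ,
      Nat.mul_div_cancel _ (by norm_num), pow_succ]
  obtain ⟨H, hT, hHcard, hH⟩ := exists_tight_subgroup (Odd.pow (by decide)) hb how hcomm3
    (fun h => hnotmem (Subgroup.zpowers_le.mpr (Subgroup.npow_mem_zpowers a 3) h))
  have hindex : H.index = 3 := by
    have := H.card_mul_index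
    rw [hHcard, hcard, show 3 ^ (t + 4) = 3 ^ (t + 1) * 9 * 3 by ring] at this
    exact Nat.eq_of_mul_eq_mul_left (by positivity) this
  have hbH : b ∈ H := hH ▸ Subgroup.subset_closure (by simp)
  have ha3H : a ^ 3 ∈ H := hH ▸ Subgroup.subset_closure (by simp)
  have haH : a ∉ H := fun h => by
    have : H = ⊤ := by
      rw [eq_top_iff, ← hgen, Subgroup.closure_le]
      rintro _ (rfl | rfl)
      · exact h
      · exact hbH
    rw [this, Subgroup.index_top] at hindex
    omega
  have hmem : ∀ x : G, x ∈ H ↔ x ^ 3 ^ (t + 2) = 1 := by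
    intro x
    obtain ⟨u, -, v, -, rfl⟩ := exists_eq_pow_mul_pow (by positivity) (by norm_num) ha1 hb hab
      hgen x
    have hcube : (a ^ u * b ^ v) ^ 3 = a ^ (u * 3) := by
      have hκ := pow_mul_pow_eq_of_commute hζb hζa
        (show b * a = ζ * (a * b) by rw [← mul_assoc, ← hconj, inv_mul_cancel_right]) v u
      rw [mul_pow_three_of_commute ((hζb.pow_left _).pow_right _) ((hζa.pow_left _).pow_right _) ?_
        hκ,
        ← pow_mul, ← pow_mul, mul_comm v, pow_mul b, hb, one_pow, mul_one]
      rw [← pow_mul, mul_comm, pow_mul, hζ3, one_pow]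
    have h1 : (a ^ u * b ^ v) ^ 3 ^ (t + 2) = 1 ↔ 3 ∣ u := by
      rw [pow_succ' 3 (t + 1), pow_mul, hcube, ← pow_mul, ← orderOf_dvd_iff_pow_eq_one, ha,
        show 3 ^ (t + 3) = 3 * 3 ^ (t + 2) by ring, mul_assoc, ← pow_succ' 3 (t + 1)]
      exact Nat.mul_dvd_mul_iff_right (show 0 < 3 ^ (t + 2) by positivity)
    rw [h1, Subgroup.mul_mem_cancel_right _ (pow_mem hbH v)]
    constructor
    · intro hu
      by_contra h3
      apply haH
      rcases (by omega : u % 3 = 1 ∨ u % 3 = 2) with h | h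
      · have e : a ^ u = (a ^ 3) ^ (u / 3) * a := by
          rw [← pow_mul, ← pow_succ]
          congr 1
          omega
        rw [e] at hu
        exact (Subgroup.mul_mem_cancel_left _ (pow_mem ha3H _)).mp hu
      · have e : a ^ u * a = (a ^ 3) ^ (u / 3 + 1) := by
          rw [← pow_mul, ← pow_succ]
          congr 1
          omega
        exact (Subgroup.mul_mem_cancel_left _ hu).mp (e ▸ pow_mem ha3H _)
    · rintro ⟨w, rfl⟩
      rw [pow_mul]
      exact pow_mem ha3H w
  refine ⟨H, Subgroup.characteristic_iff_le_comap.mpr fun φ x hx => ?_, hT, hindex⟩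
  rw [hmem] at hx
  rw [Subgroup.mem_comap, hmem, ← map_pow, hx, map_one]

/-! ### The induction over three-groups -/

theorem HasElementaryQuotient.tight_or_isModular_of_isCyclic {G : Type*} [Group G] [Finite G]
    (hG : IsPGroup 3 G) {K : Subgroup G} (hK : HasElementaryQuotient K) (hcyc : IsCyclic K) :
    Tight G ∨ ∃ r, 4 ≤ r ∧ IsModular G r := by
  obtain ⟨k, rfl⟩ := K.isCyclic_iff_exists_zpowers_eq_top.mp hcyc
  obtain ⟨m, hm⟩ := IsPGroup.iff_orderOf.mp hG k
  cases m with
  | zero =>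
    obtain rfl : k = 1 := orderOf_eq_one_iff.mp (by simpa using hm)
    have : Subsingleton (Subgroup.zpowers (1 : G)) := by
      rw [Subgroup.zpowers_one_eq_bot]
      infer_instance
    exact Or.inl (hK.tight (tight_of_subsingleton _))
  | succ i =>
    by_cases hgen : ∃ a : G, Subgroup.zpowers (a ^ 3) = Subgroup.zpowers k
    · obtain ⟨a, ha⟩ := hgen
      have ha3 : orderOf (a ^ 3) = 3 ^ (i + 1) := by
        rw [← Nat.card_zpowers, ha, Nat.card_zpowers, hm]
      obtain ⟨l, hl⟩ := IsPGroup.iff_orderOf.mp hG a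
      cases l with
      | zero =>
        obtain rfl : a = 1 := orderOf_eq_one_iff.mp (by simpa using hl)
        rw [one_pow, orderOf_one] at ha3
        exact absurd ha3.symm (Nat.one_lt_pow (by omega) (by norm_num)).ne'
      | succ l =>
        rw [orderOf_pow_of_dvd (by norm_num) (hl ▸ dvd_pow_self 3 (by omega)), hl, pow_succ,
          Nat.mul_div_cancel _ (by norm_num)] at ha3
        obtain rfl : l = i + 1 := Nat.pow_right_injective (by norm_num) ha3
        exact tight_or_isModular_of_cyclic hl (ha ▸ hK)
    · have hcube : ∀ x : G, x ^ 3 ∈ Subgroup.zpowers (k ^ 3) := by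
        intro x
        obtain ⟨n, hn⟩ := hK.pow_three_mem x
        dsimp only at hn
        by_cases h3 : (3 : ℤ) ∣ n
        · obtain ⟨q, rfl⟩ := h3
          refine ⟨q, ?_⟩
          dsimp only
          rw [← hn, zpow_mul]
          norm_cast
        · -- otherwise `x ^ 3` would generate
          refine absurd ⟨x, le_antisymm (Subgroup.zpowers_le.mpr (hK.pow_three_mem x))
            (Subgroup.zpowers_le.mpr ?_)⟩ hgen
          obtain ⟨u, v, huv⟩ : IsCoprime n ((3 : ℤ) ^ (i + 1)) :=
            ((Int.prime_three.coprime_iff_not_dvd.mpr h3).pow_left).symm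
          refine ⟨u, ?_⟩
          dsimp only
          have h1 : k ^ (v * (3 : ℤ) ^ (i + 1)) = 1 := by
            rw [← orderOf_dvd_iff_zpow_eq_one, hm]
            push_cast
            exact Dvd.intro_left _ rfl
          rw [← hn, ← zpow_mul, mul_comm]
          calc k ^ (u * n) = k ^ (u * n) * k ^ (v * (3 : ℤ) ^ (i + 1)) := by rw [h1, mul_one]
            _ = k := by rw [← zpow_add, huv, zpow_one]
      left
      cases i with
      | zero =>
        refine tight_of_exponent_three (by simpa using hm) hK fun x => ?_
        have h1 : k ^ 3 = 1 := by rw [← pow_orderOf_eq_one k, hm, zero_add, pow_one]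
        simpa [h1] using hcube x
      | succ i => exact tight_of_pow_three_mem hm hK hcube

/-- A non-cyclic finite `3`-group is tight or modular. By induction on the order: the intersection
`K` of two maximal subgroups is cyclic, or tight, or modular; in the last case it is replaced by its
characteristic subgroup of index `3`, whose quotient has order `27`. -/
theorem IsPGroup.tight_or_isModular {G : Type*} [Group G] [Finite G] (hG : IsPGroup 3 G)
    (hcyc : ¬ IsCyclic G) : Tight G ∨ ∃ r, 4 ≤ r ∧ IsModular G r := by
  induction hn : Nat.card G using Nat.strong_induction_on generalizing G with
  | _ n ih =>
  subst hn
  obtain ⟨K, hK⟩ := hG.exists_hasElementaryQuotient hcyc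
  by_cases hKc : IsCyclic K
  · exact hK.tight_or_isModular_of_isCyclic hG hKc
  have hKcard := K.card_mul_index
  rw [hK.index_eq] at hKcard
  have hKpos : 0 < Nat.card K := Nat.card_pos
  rcases ih (Nat.card K) (by omega) (hG.to_subgroup K) hKc rfl with hT | ⟨r, hr, hM⟩
  · exact Or.inl (hK.tight hT)
  · left
    have hKr : Nat.card K = 3 ^ r := hM.1
    have h81 : 3 ^ 4 ≤ 3 ^ r := Nat.pow_le_pow_right (by norm_num) hr
    have := hK.normal
    obtain ⟨H, hHchar, hHT, hHindex⟩ := hM.exists_characteristic hr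
    let N : Subgroup G := H.map K.subtype
    have hNindex : Nat.card (G ⧸ N) = 27 := by
      change N.index = 27
      rw [Subgroup.index_map_subtype, hHindex, hK.index_eq]
    have hNT : Tight N := hHT.of_mulEquiv (H.equivMapOfInjective _ K.subtype_injective)
    have hNK : N ≤ K := Subgroup.map_subtype_le H
    refine Tight.of_extension N hNT ?_
    rcases ih (Nat.card (G ⧸ N)) (by omega) (hG.to_quotient N)
      (hK.not_isCyclic_quotient hNK) rfl with h | ⟨s, hs, hMs⟩
    · exact h
    · have h1 := hMs.1
      have h2 : 3 ^ 4 ≤ 3 ^ s := Nat.pow_le_pow_right (by norm_num) hs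
      omega

theorem mainTheorem2 {G : Type*} [Group G] [Finite G] (hnil : Group.IsNilpotent G)
    (hodd : Odd (Nat.card G)) (P : Sylow 3 G)
    (hcyc : ¬ (IsCyclic P ∧ 1 < Nat.card P))
    (hL : ∀ r : ℕ, 4 ≤ r → IsEmpty (P ≃* groupL r)) :
    (graphG3 G).chromaticNumber = (Nat.card G : ℕ∞) := by
  have hP : Tight P := by
    by_cases h : IsCyclic P
    · have h1 : Nat.card P = 1 := by
        have : 0 < Nat.card P := Nat.card_pos
        have : ¬ 1 < Nat.card P := fun h2 => hcyc ⟨h, h2⟩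
        omega
      have := (Nat.card_eq_one_iff_unique.mp h1).1
      exact tight_of_subsingleton P
    · refine (P.isPGroup'.tight_or_isModular h).resolve_right ?_
      rintro ⟨r, hr, hM⟩
      exact (hM.nonempty_mulEquiv_groupL hr).elim (hL r hr).elim
  have hnormal : (P : Subgroup G).Normal :=
    P.normal_of_normalizerCondition Group.normalizerCondition_of_isNilpotent
  refine (Tight.of_extension (P : Subgroup G) hP (tight_of_isNilpotent _ ?_)).chromaticNumber_eq
  have h3 : ¬ 3 ∣ (P : Subgroup G).index := P.not_dvd_index
  have h2 : Odd (P : Subgroup G).index := hodd.of_dvd_nat (Subgroup.index_dvd_card _)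
  change Nat.Coprime (P : Subgroup G).index (2 * 3)
  exact Nat.Coprime.mul_right (Nat.coprime_two_right.mpr h2)
    ((Nat.Prime.coprime_iff_not_dvd Nat.prime_three).mpr h3).symm
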